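/- Let $d,N\ge 1$ and $\mathcal H=\mathbb C^d$. For a Borel probability measure $\nu$ on the pure states (unit vectors) $\psi$ of $\mathcal H$, write $\psi^{\otimes N}$ for the density operator $(|\psi\rangle\langle\psi|)^{\otimes N}$. An $N\to M$ quantum cloning machine (QCM) is a completely positive, trace-preserving map $\mathcal L:\mathcal B(\mathcal H^{\otimes N})\to\mathcal B(\mathcal H^{\otimes M})$; its average fidelity is $$\mathcal F_{\rm QCM}(\mathcal L,\nu)=\sum_{k=1}^M\int\frac1M\langle\psi|\,\mathrm{tr}_{\bar k}\,\mathcal L(\psi^{\otimes N})\,|\psi\rangle\,d\nu(\psi),$$ where $\mathrm{tr}_{\bar k}$ is the partial trace over all subsystems but the $k$-th. An estimation strategy consists of a POVM $\{M_j\}$ on $\mathcal H^{\otimes N}$ with finitely many outcomes and a guessed pure state $\psi_j$ for each outcome; its average fidelity is $$\sum_j\int\mathrm{tr}(M_j\psi^{\otimes N})\,|\langle\psi_j|\psi\rangle|^2\,d\nu(\psi).$$ Let $\mathcal F^{\rm opt}_{\rm QCM}(N,M)$ and $\mathcal F^{\rm opt}_{\rm est}(N)$ be the suprema of these fidelities over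 all $N\to M$ cloning machines and over all estimation strategies, respectively. (i) For every $\nu$, the asymptotic quantum cloning attack is equivalent to the challenge-estimation attack: $$\lim_{M\to\infty}\mathcal F^{\rm opt}_{\rm QCM}(N,M)=\mathcal F^{\rm opt}_{\rm est}(N).$$ (ii) Let $\nu$ be the uniform (unitarily invariant) distribution of pure states, and let $\mathcal F^{\rm opt}_{\rm UQCM}(N,M)$ be the supremum of $\mathcal F_{\rm QCM}(\mathcal L,\nu)$ over the universal cloners $\mathcal L$, i.e. those for which, for every input $\psi^{\otimes N}$, all $M$ clones are in the same reduced state, and whose single-clone fidelity is the same for all $\psi$. Then for all $M\ge N$ $$\mathcal F^{\rm opt}_{\rm UQCM}(N,M)=\frac{M-N+N(M+d)}{M(N+d)},$$ and $$\lim_{M\to\infty}\mathcal F^{\rm opt}_{\rm UQCM}(N,M)=\mathcal F^{\rm opt}_{\rm est}(N)=\frac{N+1}{N+d}.$$ -/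

import Mathlib

open MeasureTheory Filter Topology
open scoped ComplexOrder

noncomputable section

namespace QuantumCloning

/-- Operators on the `n`-fold tensor power of `ℂ^d`, written as matrices in the product basis
`|a₁⟩ ⊗ ⋯ ⊗ |aₙ⟩`, which is indexed by the words `a : Fin n → Fin d`. -/
abbrev Op (d n : ℕ) : Type := Matrix (Fin n → Fin d) (Fin n → Fin d) ℂ

/-- Normalised state vectors of `ℂ^d`; a pure state is the rank-one projection on such a vector. -/
abbrev PureState (d : ℕ) : Type := Metric.sphere (0 : EuclideanSpace ℂ (Fin d)) 1

/-- The density operator `(|ψ⟩⟨ψ|)^{⊗ n}` of `n` identical copies of the pure state `ψ`. -/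
def copies {d : ℕ} (n : ℕ) (ψ : PureState d) : Op d n :=
  fun a b => ∏ i, (ψ.1 (a i) * star (ψ.1 (b i)))

/-- The amplification `Φ ⊗ id_r` of a linear map `Φ` between matrix algebras. -/
def amplify {m n : Type} (Φ : Matrix m m ℂ →ₗ[ℂ] Matrix n n ℂ) (r : ℕ)
    (X : Matrix (m × Fin r) (m × Fin r) ℂ) : Matrix (n × Fin r) (n × Fin r) ℂ :=
  fun p q => Φ (fun a b => X (a, p.2) (b, q.2)) p.1 q.1

/-- Complete positivity: every amplification `Φ ⊗ id_r` preserves positive semidefiniteness. -/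
def IsCompletelyPositive {m n : Type} (Φ : Matrix m m ℂ →ₗ[ℂ] Matrix n n ℂ) : Prop :=
  ∀ (r : ℕ) (X : Matrix (m × Fin r) (m × Fin r) ℂ), X.PosSemidef → (amplify Φ r X).PosSemidef

/-- An `N → M` quantum cloning machine: a completely positive map from operators on `(ℂ^d)^{⊗N}`
to operators on `(ℂ^d)^{⊗M}` that preserves the trace, so that it sends density operators to
density operators. -/
structure Cloner (d N M : ℕ) where
  toMap : Op d N →ₗ[ℂ] Op d M
  completelyPositive : IsCompletelyPositive toMap
  trace_map : ∀ X, (toMap X).trace = X.trace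

/-- The reduced operator of the `k`-th subsystem: the partial trace over all subsystems but `k`. -/
def reduced {d M : ℕ} (k : Fin M) (ρ : Op d M) : Matrix (Fin d) (Fin d) ℂ :=
  fun a b => ∑ x : Fin M → Fin d, if x k = a then ρ x (Function.update x k b) else 0

/-- The fidelity `⟨ψ|σ|ψ⟩` (the real part of a number that is real whenever `σ` is Hermitian). -/
def fidelity {d : ℕ} (ψ : PureState d) (σ : Matrix (Fin d) (Fin d) ℂ) : ℝ :=
  (∑ a, ∑ b, star (ψ.1 a) * σ a b * ψ.1 b).re

/-- Fidelity of the `k`-th clone when the cloner is given `N` copies of `ψ`. -/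
def Cloner.cloneFidelity {d N M : ℕ} (L : Cloner d N M) (k : Fin M) (ψ : PureState d) : ℝ :=
  fidelity ψ (reduced k (L.toMap (copies N ψ)))

/-- Average single-clone fidelity of a cloner, for input states distributed according to `ν`. -/
def Cloner.avgFidelity {d N M : ℕ} (ν : Measure (PureState d)) (L : Cloner d N M) : ℝ :=
  ∑ k : Fin M, ∫ ψ, (1 / (M : ℝ)) * L.cloneFidelity k ψ ∂ν

/-- Universal cloners: all clones are in the same state, and the quality of the clones does not
depend on the input state. -/
def Cloner.IsUniversal {d N M : ℕ} (L : Cloner d N M) : Prop :=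
  (∀ (ψ : PureState d) (k l : Fin M),
    reduced k (L.toMap (copies N ψ)) = reduced l (L.toMap (copies N ψ))) ∧
  ∀ (k : Fin M) (ψ φ : PureState d), L.cloneFidelity k ψ = L.cloneFidelity k φ

/-- Optimal average fidelity of `N → M` cloning for input distribution `ν`. -/
def optCloning {d : ℕ} (ν : Measure (PureState d)) (N M : ℕ) : ℝ :=
  sSup (Set.range fun L : Cloner d N M => L.avgFidelity ν)

/-- An estimation strategy: a measurement (POVM) with finitely many outcomes on all `N` systems
jointly, together with a guessed pure state for each outcome. -/
structure Estimator (d N : ℕ) where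
  outcomes : ℕ
  effect : Fin outcomes → Op d N
  posSemidef : ∀ j, (effect j).PosSemidef
  sum_effect : ∑ j, effect j = 1
  guess : Fin outcomes → PureState d

/-- Average fidelity of an estimation strategy for input distribution `ν`: outcome `j` has
probability `tr (M_j ψ^{⊗N})` and then contributes `|⟨ψ_j|ψ⟩|²`. -/
def Estimator.avgFidelity {d N : ℕ} (ν : Measure (PureState d)) (E : Estimator d N) : ℝ :=
  ∑ j, ∫ ψ, ((E.effect j * copies N ψ).trace).re * ‖inner ℂ (E.guess j).1 ψ.1‖ ^ 2 ∂ν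

/-- Optimal average fidelity of state estimation from `N` copies for input distribution `ν`. -/
def optEstimation {d : ℕ} (ν : Measure (PureState d)) (N : ℕ) : ℝ :=
  sSup (Set.range fun E : Estimator d N => E.avgFidelity ν)

/-- The uniform (unitarily invariant) probability distribution of pure states: the normalised
surface measure of the unit sphere of `ℂ^d`. -/
def uniform (d : ℕ) : Measure (PureState d) :=
  ((volume : Measure (EuclideanSpace ℂ (Fin d))).toSphere Set.univ)⁻¹ •
    (volume : Measure (EuclideanSpace ℂ (Fin d))).toSphere

/-- Optimal fidelity of universal `N → M` cloning, averaged over uniformly distributed inputs. -/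
def optUniversalCloning (d N M : ℕ) : ℝ :=
  sSup {F : ℝ | ∃ L : Cloner d N M, L.IsUniversal ∧ F = L.avgFidelity (uniform d)}

end QuantumCloning

end

noncomputable section

namespace QuantumCloning

/-! ### Sums over words -/

/-! Cloning is at least as good as estimation, because measuring the input and preparing `M` copies
of the guess is a cloner with the same fidelity (`Estimator.avgFidelity_toCloner`). For the
converse, each of the `M` clones is measured separately with an informationally complete measurement
whose outcomes carry Hermitian, trace-one, unbiased estimates of the local state. By linearity the
mean of these estimates reproduces the average single-clone fidelity exactly, however the clones are
correlated. The mean need not be positive, but the expectation of `exp (-t ∑ₖ fₖ)`, with `fₖ` the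
estimated fidelities with a fixed state, equals `tr (G^{⊗M} ρ)` for a one-system operator `G ≤ 1 +
O(t²)`. Taking `t = 1/√M` shows that its negative part has expectation `O(1/√M)`
(`Tomography.sum_prob_mul_neg_le`). A finite net of states and a small multiple of the identity then
turn the mean into a density operator at negligible cost. Pulled back through the cloner, the local
measurements form an estimation strategy on the input, and the error is uniform over all cloners
(`eventually_avgFidelity_le`).

For uniform inputs the average of `ψ^{⊗n}` is the normalised projection onto the symmetric subspace
(`integral_copies_uniform`, from Gaussian integrals). The fidelity of a cloner thereby becomes a
quadratic form in its Kraus operators, given by a sum over permutations of `N + 1` factors. The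
permutations fixing the extra factor contribute norms, and the others contribute contractions of an
output index with an input index, which `sum_contraction_le` bounds sharply. Equality is attained by
adjoining a maximally mixed system and symmetrising, one system at a time: if `F` is the sum of the
clone fidelities on `n` systems, each step multiplies `1 + F` by `(d + n + 1)/(d + n)`
(`totalFidelity_stepMap`).

The upper bound holds for all cloners, not just universal ones. The value of optimal estimation
therefore follows by letting `M → ∞` in the cloning formula and using the first part. -/

lemma update_comp_perm {d n : ℕ} (x : Fin n → Fin d) (k : Fin n) (c : Fin d)
    (σ : Equiv.Perm (Fin n)) :
    Function.update x (σ k) c ∘ σ = Function.update (x ∘ σ) k c := by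
  rw [Function.update_comp_equiv]
  simp

/-- Exchanging the letter at position `k` with an external letter is a bijection. -/
lemma sum_update_swap {d n : ℕ} {E : Type*} [AddCommMonoid E] (k : Fin n)
    (H : (Fin n → Fin d) → Fin d → E) :
    ∑ x, ∑ c, H (Function.update x k c) (x k) = ∑ x, ∑ c, H x c := by
  rw [← Fintype.sum_prod_type', ← Fintype.sum_prod_type']
  have inv : Function.Involutive
      (fun p : (Fin n → Fin d) × Fin d => (Function.update p.1 k p.2, p.1 k)) := by
    intro p
    simp
  exact Equiv.sum_comp (inv.toPerm _) (fun p => H p.1 p.2)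

/-- Freeing one letter of a word counts every word `d` times. This is the source of the factors `d`
in the later identities: multiplying by `d` frees a letter that can then be contracted. -/
lemma sum_update_const {d n : ℕ} {E : Type*} [AddCommMonoid E] (k : Fin n)
    (F : (Fin n → Fin d) → E) :
    ∑ x, ∑ c, F (Function.update x k c) = d • ∑ x, F x := by
  rw [sum_update_swap k (fun x _ => F x)]
  simp [Finset.sum_nsmul]

/-- Summing over the words that agree with `x` away from `k`. -/
lemma sum_ite_eq_update {d n : ℕ} {E : Type*} [AddCommMonoid E] (k : Fin n)
    (x : Fin n → Fin d) (F : (Fin n → Fin d) → E) :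
    ∑ y, (if y = Function.update x k (y k) then F y else 0) =
      ∑ c, F (Function.update x k c) := by
  have h : ∀ y : Fin n → Fin d, (if y = Function.update x k (y k) then F y else 0) =
      ∑ c, if y = Function.update x k c then F y else 0 := by
    intro y
    rw [Finset.sum_eq_single (y k)]
    · intro c _ hc
      rw [if_neg]
      intro h
      exact hc (by rw [h]; simp)
    · simp
  simp_rw [h]
  rw [Finset.sum_comm]
  simp

lemma eq_update_comm {d n : ℕ} (k : Fin n) (x y : Fin n → Fin d) :
    y = Function.update x k (y k) ↔ x = Function.update y k (x k) := by
  constructor <;> intro h <;> rw [h] <;> simp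

/-! ### The operator permuting the tensor factors -/

/-- The sum of all permutations of the tensor factors, i.e. `n!` times the projection onto the
symmetric subspace. -/
def symm (d n : ℕ) : Op d n :=
  fun a b => ∑ σ : Equiv.Perm (Fin n), if a ∘ σ = b then 1 else 0

lemma symm_comp_left {d n : ℕ} (a b : Fin n → Fin d) (π : Equiv.Perm (Fin n)) :
    symm d n (a ∘ π) b = symm d n a b := by
  unfold symm
  exact Equiv.sum_comp (Equiv.mulLeft π)
    (fun σ : Equiv.Perm (Fin n) => if a ∘ σ = b then (1 : ℂ) else 0)

lemma symm_comm {d n : ℕ} (a b : Fin n → Fin d) : symm d n a b = symm d n b a := by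
  unfold symm
  rw [← Equiv.sum_comp (Equiv.inv (Equiv.Perm (Fin n)))]
  refine Finset.sum_congr rfl fun σ _ => ?_
  congr 1
  simp only [Equiv.inv_apply, eq_iff_iff]
  constructor
  · rintro rfl
    ext i; simp
  · rintro rfl
    ext i; simp

lemma symm_comp_right {d n : ℕ} (a b : Fin n → Fin d) (π : Equiv.Perm (Fin n)) :
    symm d n a (b ∘ π) = symm d n a b := by
  rw [symm_comm, symm_comp_left, symm_comm]

lemma star_symm {d n : ℕ} (a b : Fin n → Fin d) : star (symm d n a b) = symm d n a b := by
  simp [symm]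

lemma symm_isHermitian (d n : ℕ) : (symm d n).conjTranspose = symm d n := by
  ext a b
  rw [Matrix.conjTranspose_apply, star_symm, symm_comm]

/-- A permutation of `n + 1` factors either fixes the new factor `0` or sends it to some `i.succ`.
After this choice a permutation of the other `n` factors remains, acting on `u` with its `i`-th
letter exchanged for `c`. -/
lemma symm_cons {d n : ℕ} (c c' : Fin d) (u v : Fin n → Fin d) :
    symm d (n + 1) (Fin.cons c u) (Fin.cons c' v) =
      (if c = c' then symm d n u v else 0) +
        ∑ i, if u i = c' then symm d n (Function.update u i c) v else 0 := by
  have key : ∀ (p : Fin (n + 1)) (e : Equiv.Perm (Fin n)),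
      (((Fin.cons c u : Fin (n + 1) → Fin d) ∘ Equiv.Perm.decomposeFin.symm (p, e) =
        (Fin.cons c' v : Fin (n + 1) → Fin d))) ↔
      (Fin.cons c u : Fin (n + 1) → Fin d) p = c' ∧
        (fun j => (Fin.cons c u : Fin (n + 1) → Fin d) (Equiv.swap 0 p (Fin.succ j))) ∘ e = v := by
    intro p e
    rw [funext_iff, Fin.forall_fin_succ, funext_iff]
    simp
  conv_lhs => unfold symm
  rw [← Equiv.sum_comp Equiv.Perm.decomposeFin.symm, Fintype.sum_prod_type]
  simp_rw [key]
  rw [Fin.sum_univ_succ]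
  congr 1
  · by_cases h : c = c' <;> simp [h, symm]
  · refine Finset.sum_congr rfl fun i _ => ?_
    have h2 : (fun j => (Fin.cons c u : Fin (n + 1) → Fin d)
        (Equiv.swap 0 i.succ (Fin.succ j))) = Function.update u i c := by
      ext j
      by_cases hj : j = i
      · subst hj; simp
      · rw [Equiv.swap_apply_of_ne_of_ne (Fin.succ_ne_zero _)
          (fun h => hj (Fin.succ_injective _ h))]
        simp [hj]
    simp only [Fin.cons_succ, h2]
    by_cases h : u i = c' <;> simp [h, symm]

/-- In `symm_cons` with equal new letters, the fixing permutations contribute once for each of the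
`d` letters. For each of the `n` positions `i` only `c = u i` contributes, and it leaves `u`
unchanged. -/
lemma symm_partialTrace {d n : ℕ} (u v : Fin n → Fin d) :
    ∑ c, symm d (n + 1) (Fin.cons c u) (Fin.cons c v) = (d + n) * symm d n u v := by
  simp_rw [symm_cons]
  rw [Finset.sum_add_distrib, Finset.sum_comm]
  simp [add_mul]

/-- The trace of `symm d n`, i.e. the rising factorial `d (d + 1) ⋯ (d + n - 1)`. -/
def symmTrace (d n : ℕ) : ℝ := ∏ i ∈ Finset.range n, ((d : ℝ) + i)

lemma symmTrace_pos {d : ℕ} (hd : 1 ≤ d) (n : ℕ) : 0 < symmTrace d n := by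
  refine Finset.prod_pos fun i _ => ?_
  have : (1 : ℝ) ≤ d := by exact_mod_cast hd
  positivity

lemma sum_cons {d n : ℕ} {E : Type*} [AddCommMonoid E] (F : (Fin (n + 1) → Fin d) → E) :
    ∑ x, F x = ∑ c, ∑ u : Fin n → Fin d, F (Fin.cons c u) := by
  rw [← Equiv.sum_comp (Fin.consEquiv (fun _ => Fin d)), Fintype.sum_prod_type]
  rfl

lemma trace_symm (d n : ℕ) : (symm d n).trace = symmTrace d n := by
  induction n with
  | zero => simp [Matrix.trace, symm, symmTrace, Subsingleton.elim _ (fun i : Fin 0 => i.elim0)]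
  | succ n ih =>
    rw [Matrix.trace]
    simp only [Matrix.diag_apply]
    rw [sum_cons, Finset.sum_comm]
    simp_rw [symm_partialTrace]
    rw [← Finset.mul_sum]
    have : ∑ u, symm d n u u = symmTrace d n := ih
    rw [this, symmTrace, symmTrace, Finset.prod_range_succ]
    push_cast
    ring

lemma symm_mul_apply {d n : ℕ} {β : Type*} (X : Matrix (Fin n → Fin d) β ℂ)
    (a : Fin n → Fin d) (b : β) :
    (symm d n * X) a b = ∑ σ : Equiv.Perm (Fin n), X (a ∘ σ) b := by
  simp only [Matrix.mul_apply, symm, Finset.sum_mul]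
  rw [Finset.sum_comm]
  simp

lemma mul_symm_apply {d n : ℕ} {β : Type*} (X : Matrix β (Fin n → Fin d) ℂ)
    (a : β) (b : Fin n → Fin d) :
    (X * symm d n) a b = ∑ σ : Equiv.Perm (Fin n), X a (b ∘ σ) := by
  have h : ∀ c, symm d n c b = symm d n b c := fun c => symm_comm c b
  simp only [Matrix.mul_apply, h]
  simp only [symm, Finset.mul_sum]
  rw [Finset.sum_comm]
  simp

lemma symm_mul_of_invariant {d n : ℕ} {β : Type*} {X : Matrix (Fin n → Fin d) β ℂ}
    (hX : ∀ a b (σ : Equiv.Perm (Fin n)), X (a ∘ σ) b = X a b) :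
    symm d n * X = (n.factorial : ℂ) • X := by
  ext a b
  rw [symm_mul_apply]
  simp [hX, Fintype.card_perm]

lemma mul_symm_of_invariant {d n : ℕ} {β : Type*} {X : Matrix β (Fin n → Fin d) ℂ}
    (hX : ∀ a b (σ : Equiv.Perm (Fin n)), X a (b ∘ σ) = X a b) :
    X * symm d n = (n.factorial : ℂ) • X := by
  ext a b
  rw [mul_symm_apply]
  simp [hX, Fintype.card_perm]

lemma symm_mul_symm (d n : ℕ) :
    symm d n * symm d n = (n.factorial : ℂ) • symm d n :=
  symm_mul_of_invariant fun a b σ => symm_comp_left a b σ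

/-! ### Operators acting on one tensor factor -/

/-- The operator `B` acting on the `k`-th tensor factor. -/
def site {d n : ℕ} (k : Fin n) (B : Matrix (Fin d) (Fin d) ℂ) : Op d n :=
  fun x y => if y = Function.update x k (y k) then B (x k) (y k) else 0

lemma site_mul_apply {d n : ℕ} {β : Type*} (k : Fin n) (B : Matrix (Fin d) (Fin d) ℂ)
    (X : Matrix (Fin n → Fin d) β ℂ) (x : Fin n → Fin d) (b : β) :
    (site k B * X) x b = ∑ c, B (x k) c * X (Function.update x k c) b := by
  simp only [Matrix.mul_apply, site, ite_mul, zero_mul]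
  rw [sum_ite_eq_update k x (fun y => B (x k) (y k) * X y b)]
  simp

lemma mul_site_apply {d n : ℕ} {β : Type*} (k : Fin n) (B : Matrix (Fin d) (Fin d) ℂ)
    (X : Matrix β (Fin n → Fin d) ℂ) (b : β) (y : Fin n → Fin d) :
    (X * site k B) b y = ∑ c, X b (Function.update y k c) * B c (y k) := by
  simp only [Matrix.mul_apply, site, mul_ite, mul_zero]
  simp_rw [eq_update_comm k _ y]
  rw [sum_ite_eq_update k y (fun x => X b x * B (x k) (y k))]
  simp

lemma site_comp_perm {d n : ℕ} (k : Fin n) (B : Matrix (Fin d) (Fin d) ℂ)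
    (σ : Equiv.Perm (Fin n)) (x y : Fin n → Fin d) :
    site k B (x ∘ σ) (y ∘ σ) = site (σ k) B x y := by
  unfold site
  simp only [Function.comp_apply]
  simp only [← update_comp_perm, (Equiv.surjective σ).injective_comp_right.eq_iff]

/-- The pure state `|ψ⟩⟨ψ|`. -/
def proj {d : ℕ} (ψ : PureState d) : Matrix (Fin d) (Fin d) ℂ :=
  fun a b => ψ.1 a * star (ψ.1 b)

lemma trace_proj {d : ℕ} (ψ : PureState d) : (proj ψ).trace = 1 := by
  have h : ‖ψ.1‖ = 1 := by simp
  have h2 := EuclideanSpace.norm_sq_eq ψ.1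
  rw [h] at h2
  simp only [Matrix.trace, Matrix.diag_apply, proj]
  have : ∀ a, ψ.1 a * star (ψ.1 a) = ((‖ψ.1 a‖ ^ 2 : ℝ) : ℂ) := by
    intro a
    simp [Complex.mul_conj, Complex.normSq_eq_norm_sq]
  simp_rw [this]
  rw [← Complex.ofReal_sum, ← h2]
  simp

lemma fidelity_eq_trace {d : ℕ} (ψ : PureState d) (σ : Matrix (Fin d) (Fin d) ℂ) :
    fidelity ψ σ = (σ * proj ψ).trace.re := by
  unfold fidelity
  congr 1
  simp only [Matrix.trace, Matrix.diag_apply, Matrix.mul_apply, proj]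
  refine Finset.sum_congr rfl fun a _ => Finset.sum_congr rfl fun b _ => ?_
  ring

lemma trace_reduced_mul {d M : ℕ} (k : Fin M) (ρ : Op d M) (B : Matrix (Fin d) (Fin d) ℂ) :
    (reduced k ρ * B).trace = (ρ * site k B).trace := by
  simp only [Matrix.trace, Matrix.diag_apply, mul_site_apply]
  simp only [Matrix.mul_apply, reduced, Finset.sum_mul, ite_mul, zero_mul]
  rw [Finset.sum_comm]
  simp_rw [Finset.sum_comm (s := (Finset.univ : Finset (Fin d)))
    (t := (Finset.univ : Finset (Fin M → Fin d)))]
  simp only [Finset.sum_ite_eq, Finset.mem_univ, if_true]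

lemma fidelity_reduced {d M : ℕ} (k : Fin M) (ρ : Op d M) (ψ : PureState d) :
    fidelity ψ (reduced k ρ) = (ρ * site k (proj ψ)).trace.re := by
  rw [fidelity_eq_trace, trace_reduced_mul]

/-! ### Completely positive maps -/

section CompletelyPositive

variable {m n : Type}

lemma IsCompletelyPositive.add {Φ Ψ : Matrix m m ℂ →ₗ[ℂ] Matrix n n ℂ}
    (hΦ : IsCompletelyPositive Φ) (hΨ : IsCompletelyPositive Ψ) :
    IsCompletelyPositive (Φ + Ψ) := fun r X hX => (hΦ r X hX).add (hΨ r X hX)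

lemma IsCompletelyPositive.zero : IsCompletelyPositive (0 : Matrix m m ℂ →ₗ[ℂ] Matrix n n ℂ) :=
  fun _ _ _ => Matrix.PosSemidef.zero

lemma IsCompletelyPositive.sum {ι : Type*} (s : Finset ι)
    {Φ : ι → Matrix m m ℂ →ₗ[ℂ] Matrix n n ℂ} (hΦ : ∀ i, IsCompletelyPositive (Φ i)) :
    IsCompletelyPositive (∑ i ∈ s, Φ i) :=
  Finset.sum_induction _ IsCompletelyPositive (fun _ _ => IsCompletelyPositive.add)
    IsCompletelyPositive.zero fun i _ => hΦ i

lemma IsCompletelyPositive.smul {Φ : Matrix m m ℂ →ₗ[ℂ] Matrix n n ℂ}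
    (hΦ : IsCompletelyPositive Φ) {c : ℝ} (hc : 0 ≤ c) :
    IsCompletelyPositive ((c : ℂ) • Φ) :=
  fun r X hX => (hΦ r X hX).smul (Complex.zero_le_real.mpr hc)

lemma IsCompletelyPositive.comp {l : Type} {Φ : Matrix m m ℂ →ₗ[ℂ] Matrix n n ℂ}
    {Ψ : Matrix l l ℂ →ₗ[ℂ] Matrix m m ℂ} (hΦ : IsCompletelyPositive Φ)
    (hΨ : IsCompletelyPositive Ψ) : IsCompletelyPositive (Φ ∘ₗ Ψ) :=
  fun r X hX => hΦ r _ (hΨ r X hX)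

lemma IsCompletelyPositive.id : IsCompletelyPositive (LinearMap.id : Matrix m m ℂ →ₗ[ℂ] _) :=
  fun _ _ hX => hX

variable [Fintype m]

/-- The map `X ↦ K X K†`. -/
def conjMap (K : Matrix n m ℂ) : Matrix m m ℂ →ₗ[ℂ] Matrix n n ℂ where
  toFun X := K * X * K.conjTranspose
  map_add' X Y := by rw [Matrix.mul_add, Matrix.add_mul]
  map_smul' c X := by simp

lemma conjMap_apply (K : Matrix n m ℂ) (X : Matrix m m ℂ) :
    conjMap K X = K * X * K.conjTranspose := rfl

lemma isCompletelyPositive_conjMap [Finite n] (K : Matrix n m ℂ) :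
    IsCompletelyPositive (conjMap K) := by
  intro r X hX
  have : amplify (conjMap K) r X =
      (Matrix.of fun (p : n × Fin r) (q : m × Fin r) => if p.2 = q.2 then K p.1 q.1 else 0) * X *
      (Matrix.of fun (p : n × Fin r) (q : m × Fin r) =>
        if p.2 = q.2 then K p.1 q.1 else 0).conjTranspose := by
    ext p q
    change (K * Matrix.of (fun a b => X (a, p.2) (b, q.2)) * K.conjTranspose) p.1 q.1 = _
    simp only [Matrix.mul_apply, Matrix.conjTranspose_apply, Matrix.of_apply,
      Fintype.sum_prod_type]
    simp [apply_ite, ite_mul]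
  rw [this]
  exact hX.mul_mul_conjTranspose_same _

/-- The map `X ↦ tr (Q X) ρ` that tests for the effect `Q` and prepares `ρ`. -/
def prepareMap (Q : Matrix m m ℂ) (ρ : Matrix n n ℂ) : Matrix m m ℂ →ₗ[ℂ] Matrix n n ℂ where
  toFun X := (Q * X).trace • ρ
  map_add' X Y := by rw [Matrix.mul_add, Matrix.trace_add, add_smul]
  map_smul' c X := by simp [mul_smul]

lemma prepareMap_apply (Q : Matrix m m ℂ) (ρ : Matrix n n ℂ) (X : Matrix m m ℂ) :
    prepareMap Q ρ X = (Q * X).trace • ρ := rfl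

/-- Rank-one decompositions `Q = ∑ v v†` and `ρ = ∑ w w†` give the Kraus operators `w v†`. -/
lemma isCompletelyPositive_prepareMap [Finite n] {Q : Matrix m m ℂ} {ρ : Matrix n n ℂ}
    (hQ : Q.PosSemidef) (hρ : ρ.PosSemidef) : IsCompletelyPositive (prepareMap Q ρ) := by
  obtain ⟨s, v, rfl⟩ := Matrix.posSemidef_iff_eq_sum_vecMulVec.mp hQ
  obtain ⟨t, w, rfl⟩ := Matrix.posSemidef_iff_eq_sum_vecMulVec.mp hρ
  have : prepareMap (∑ i, Matrix.vecMulVec (v i) (star (v i)))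
      (∑ j, Matrix.vecMulVec (w j) (star (w j))) =
      ∑ i, ∑ j, conjMap (Matrix.vecMulVec (w j) (star (v i))) := by
    ext1 X
    simp only [prepareMap_apply, LinearMap.sum_apply, conjMap_apply, Finset.sum_mul,
      Matrix.trace_sum, Finset.sum_smul, Finset.smul_sum]
    rw [Finset.sum_comm]
    refine Finset.sum_congr rfl fun i _ => Finset.sum_congr rfl fun j _ => ?_
    ext p q
    simp only [Matrix.smul_apply, smul_eq_mul, Matrix.trace, Matrix.diag_apply, Matrix.mul_apply,
      Matrix.vecMulVec_apply, Matrix.conjTranspose_apply, Pi.star_apply, star_mul', star_star,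
      Finset.sum_mul]
    refine Finset.sum_congr rfl fun a _ => Finset.sum_congr rfl fun b _ => ?_
    ring
  rw [this]
  exact .sum _ fun i => .sum _ fun j => isCompletelyPositive_conjMap _

end CompletelyPositive

/-! ### The optimal universal cloner -/

lemma posSemidef_one_sub_symm (d n : ℕ) :
    (1 - (n.factorial : ℂ)⁻¹ • symm d n : Op d n).PosSemidef := by
  have hn : (n.factorial : ℂ) ≠ 0 := by exact_mod_cast n.factorial_ne_zero
  have h : (1 - (n.factorial : ℂ)⁻¹ • symm d n : Op d n) =
      (1 - (n.factorial : ℂ)⁻¹ • symm d n : Op d n).conjTranspose *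
        (1 - (n.factorial : ℂ)⁻¹ • symm d n : Op d n) := by
    rw [Matrix.conjTranspose_sub, Matrix.conjTranspose_smul, symm_isHermitian,
      Matrix.sub_mul, Matrix.mul_sub, Matrix.mul_sub]
    simp only [Matrix.conjTranspose_one, one_mul, mul_one, star_inv₀, star_natCast,
      Matrix.smul_mul, Matrix.mul_smul, symm_mul_symm, smul_smul]
    rw [inv_mul_cancel₀ hn]
    simp
  rw [h]
  exact Matrix.posSemidef_conjTranspose_mul_self _

/-- The Kraus operator that adjoins the basis state `c` to `n` systems and symmetrises. -/
def adjoin (d n : ℕ) (c : Fin d) : Matrix (Fin (n + 1) → Fin d) (Fin n → Fin d) ℂ :=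
  fun x u => symm d (n + 1) x (Fin.cons c u)

/-- The map underlying optimal universal cloning from `n` to `n + 1` systems. -/
def stepMap (d n : ℕ) : Op d n →ₗ[ℂ] Op d (n + 1) :=
  -- With `P = symm d n / n!` the symmetric projection, the constant makes the first summand have
  -- trace `tr (P X)`, by `sum_adjoin_conj`. The second summand prepares the maximally mixed state
  -- with weight `tr ((1 - P) X)`. It only restores trace preservation off the symmetric subspace.
  ((((n + 1).factorial * n.factorial * (d + n) : ℝ)⁻¹ : ℝ) : ℂ) • ∑ c, conjMap (adjoin d n c) +
    prepareMap (1 - (n.factorial : ℂ)⁻¹ • symm d n) (((d ^ (n + 1) : ℝ)⁻¹ : ℝ) • 1)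

lemma adjoin_conjTranspose_apply (d n : ℕ) (c : Fin d) (u : Fin n → Fin d)
    (x : Fin (n + 1) → Fin d) :
    (adjoin d n c).conjTranspose u x = symm d (n + 1) (Fin.cons c u) x := by
  rw [Matrix.conjTranspose_apply, adjoin, star_symm, symm_comm]

lemma adjoin_conj_apply {d n : ℕ} (c : Fin d) (A : Op d (n + 1)) (v u : Fin n → Fin d) :
    ((adjoin d n c).conjTranspose * A * adjoin d n c) v u =
      (symm d (n + 1) * A * symm d (n + 1)) (Fin.cons c v) (Fin.cons c u) := by
  simp only [Matrix.mul_apply, adjoin_conjTranspose_apply, adjoin]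

lemma sum_adjoin_conj (d n : ℕ) :
    ∑ c, (adjoin d n c).conjTranspose * adjoin d n c =
      ((n + 1).factorial * (d + n) : ℂ) • symm d n := by
  ext v u
  have h := fun c : Fin d => adjoin_conj_apply c (1 : Op d (n + 1)) v u
  simp only [Matrix.mul_one, symm_mul_symm] at h
  rw [Matrix.sum_apply]
  simp only [h, Matrix.smul_apply, smul_eq_mul]
  rw [← Finset.mul_sum, symm_partialTrace, mul_assoc]

lemma trace_stepMap {d : ℕ} (hd : 1 ≤ d) (n : ℕ) (X : Op d n) :
    (stepMap d n X).trace = X.trace := by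
  have hd' : (d : ℂ) ≠ 0 := by exact_mod_cast (by omega : d ≠ 0)
  have hdn : (d + n : ℂ) ≠ 0 := by exact_mod_cast (by omega : d + n ≠ 0)
  have hn : (n.factorial : ℂ) ≠ 0 := by exact_mod_cast n.factorial_ne_zero
  have hn1 : ((n + 1).factorial : ℂ) ≠ 0 := by exact_mod_cast (n + 1).factorial_ne_zero
  have h1 : (∑ c, conjMap (adjoin d n c) X).trace =
      ((n + 1).factorial * (d + n) : ℂ) * (symm d n * X).trace := by
    rw [Matrix.trace_sum]
    have : ∀ c, (conjMap (adjoin d n c) X).trace =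
        ((adjoin d n c).conjTranspose * adjoin d n c * X).trace := by
      intro c
      rw [conjMap_apply, Matrix.trace_mul_comm, Matrix.mul_assoc]
    simp_rw [this]
    rw [← Matrix.trace_sum, ← Finset.sum_mul, sum_adjoin_conj, Matrix.smul_mul, Matrix.trace_smul,
      smul_eq_mul]
  simp only [stepMap, LinearMap.add_apply, LinearMap.smul_apply, LinearMap.sum_apply,
    prepareMap_apply, Matrix.trace_add, Matrix.trace_smul, h1, Matrix.sub_mul, Matrix.one_mul,
    Matrix.trace_sub, Matrix.smul_mul, Matrix.trace_one, Fintype.card_fun, Fintype.card_fin,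
    smul_eq_mul, Complex.real_smul]
  push_cast
  field_simp
  ring

lemma isCompletelyPositive_stepMap (d n : ℕ) : IsCompletelyPositive (stepMap d n) := by
  refine .add (.smul (.sum _ fun c => isCompletelyPositive_conjMap _) (by positivity))
    (isCompletelyPositive_prepareMap (posSemidef_one_sub_symm d n) ?_)
  have h := (Matrix.PosSemidef.one (n := Fin (n + 1) → Fin d) (R := ℂ)).smul
    (Complex.zero_le_real.mpr (by positivity : 0 ≤ ((d ^ (n + 1) : ℝ)⁻¹)))
  exact h

/-- Cloning one more system at a time, from `N` to `N + m`. -/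
def iterateMap (d N : ℕ) : (m : ℕ) → Op d N →ₗ[ℂ] Op d (N + m)
  | 0 => LinearMap.id
  | m + 1 => stepMap d (N + m) ∘ₗ iterateMap d N m

/-- The optimal universal `N → N + m` cloner. -/
def universalCloner {d : ℕ} (hd : 1 ≤ d) (N m : ℕ) : Cloner d N (N + m) where
  toMap := iterateMap d N m
  completelyPositive := by
    induction m with
    | zero => exact .id
    | succ m ih => exact (isCompletelyPositive_stepMap d (N + m)).comp ih
  trace_map X := by
    induction m with
    | zero => rfl
    | succ m ih => exact (trace_stepMap hd (N + m) _).trans ih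

/-- An operator supported on the symmetric subspace. -/
def IsSymmetric {d n : ℕ} (ρ : Op d n) : Prop :=
  (∀ x y (σ : Equiv.Perm (Fin n)), ρ (x ∘ σ) y = ρ x y) ∧
    ∀ x y (σ : Equiv.Perm (Fin n)), ρ x (y ∘ σ) = ρ x y

lemma isSymmetric_copies {d : ℕ} (n : ℕ) (ψ : PureState d) : IsSymmetric (copies n ψ) := by
  constructor <;> intro x y σ <;> simp only [copies, Finset.prod_mul_distrib] <;> congr 1
  · exact Equiv.prod_comp σ (fun i => ψ.1 (x i))
  · exact Equiv.prod_comp σ (fun i => star (ψ.1 (y i)))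

/-- The filler term is weighted by `tr ((1 - P) ρ)`, which vanishes on the symmetric subspace. -/
lemma stepMap_apply_of_isSymmetric {d n : ℕ} {ρ : Op d n} (hρ : IsSymmetric ρ) :
    stepMap d n ρ = ((((n + 1).factorial * n.factorial * (d + n) : ℝ)⁻¹ : ℝ) : ℂ) •
      ∑ c, conjMap (adjoin d n c) ρ := by
  have hn : (n.factorial : ℂ) ≠ 0 := by exact_mod_cast n.factorial_ne_zero
  simp only [stepMap, LinearMap.add_apply, LinearMap.smul_apply, LinearMap.sum_apply,
    prepareMap_apply, Matrix.sub_mul, Matrix.one_mul, Matrix.smul_mul,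
    symm_mul_of_invariant hρ.1, smul_smul, inv_mul_cancel₀ hn, one_smul, sub_self,
    Matrix.trace_zero, zero_smul, add_zero]

lemma isSymmetric_stepMap {d n : ℕ} {ρ : Op d n} (hρ : IsSymmetric ρ) :
    IsSymmetric (stepMap d n ρ) := by
  rw [stepMap_apply_of_isSymmetric hρ]
  constructor
  · intro x y σ
    simp only [Matrix.smul_apply, Matrix.sum_apply, conjMap_apply, Matrix.mul_assoc]
    simp only [Matrix.mul_apply (M := adjoin d n _), adjoin, symm_comp_left]
  · intro x y σ
    simp only [Matrix.smul_apply, Matrix.sum_apply, conjMap_apply]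
    simp only [Matrix.mul_apply (N := (adjoin d n _).conjTranspose), adjoin_conjTranspose_apply,
      symm_comp_right]

lemma isSymmetric_iterateMap {d N : ℕ} {ρ : Op d N} (hρ : IsSymmetric ρ) (m : ℕ) :
    IsSymmetric (iterateMap d N m ρ) := by
  induction m with
  | zero => exact hρ
  | succ m ih => exact isSymmetric_stepMap ih

lemma reduced_eq_of_isSymmetric {d n : ℕ} {ρ : Op d n} (hρ : IsSymmetric ρ) (k l : Fin n) :
    reduced k ρ = reduced l ρ := by
  ext a b
  unfold reduced
  rw [← Equiv.sum_comp (Equiv.arrowCongr (Equiv.swap k l) (Equiv.refl (Fin d)))]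
  refine Finset.sum_congr rfl fun x _ => ?_
  have h1 : (Equiv.arrowCongr (Equiv.swap k l) (Equiv.refl (Fin d))) x = x ∘ Equiv.swap k l := by
    ext i; simp [Equiv.arrowCongr]
  rw [h1, hρ.1]
  have h2 : Function.update (x ∘ Equiv.swap k l) k b =
      Function.update x l b ∘ Equiv.swap k l := by
    rw [← update_comp_perm]
    simp
  rw [h2, hρ.2]
  simp

/-- The sum of the operators `B` acting on each of the tensor factors. -/
def siteSum {d : ℕ} (n : ℕ) (B : Matrix (Fin d) (Fin d) ℂ) : Op d n := ∑ k, site k B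

lemma siteSum_comp_perm {d n : ℕ} (B : Matrix (Fin d) (Fin d) ℂ)
    (σ : Equiv.Perm (Fin n)) (x y : Fin n → Fin d) :
    siteSum n B (x ∘ σ) (y ∘ σ) = siteSum n B x y := by
  simp only [siteSum, Matrix.sum_apply, site_comp_perm]
  exact Equiv.sum_comp σ (fun k => site k B x y)

/-- Permuting the factors permutes the summands `site k B`, so their sum commutes with every
permutation although no single summand need do so. -/
lemma siteSum_commute_symm {d n : ℕ} (B : Matrix (Fin d) (Fin d) ℂ) :
    siteSum n B * symm d n = symm d n * siteSum n B := by
  ext x y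
  rw [mul_symm_apply, symm_mul_apply, ← Equiv.sum_comp (Equiv.inv _)]
  refine Finset.sum_congr rfl fun σ _ => ?_
  rw [← siteSum_comp_perm B σ]
  congr 1
  ext i; simp

lemma siteSum_cons {d n : ℕ} (B : Matrix (Fin d) (Fin d) ℂ) (c c' : Fin d)
    (u v : Fin n → Fin d) :
    siteSum (n + 1) B (Fin.cons c u) (Fin.cons c' v) =
      (if v = u then B c c' else 0) + if c' = c then siteSum n B u v else 0 := by
  simp only [siteSum, Matrix.sum_apply]
  rw [Fin.sum_univ_succ]
  congr 1
  · simp [site, Fin.update_cons_zero, Fin.cons_inj]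
  · simp only [site, Fin.cons_succ, ← Fin.cons_update, Fin.cons_inj]
    by_cases h : c' = c <;> simp [h]

/-- The Heisenberg picture of one cloning step. Since `siteSum` commutes with `symm`, one
symmetriser is absorbed and a partial trace over the new factor remains. With `B` on the new factor,
the two cases of `symm_cons` give the `B.trace` term and `siteSum n B * symm d n`. With `B` on an
old factor, `symm_partialTrace` gives the factor `d + n`. -/
lemma sum_adjoin_conj_siteSum {d n : ℕ} (B : Matrix (Fin d) (Fin d) ℂ) :
    ∑ c, (adjoin d n c).conjTranspose * siteSum (n + 1) B * adjoin d n c =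
      ((n + 1).factorial : ℂ) • (B.trace • symm d n + siteSum n B * symm d n +
        (d + n : ℂ) • (symm d n * siteSum n B)) := by
  ext v u
  have h1 : symm d (n + 1) * siteSum (n + 1) B * symm d (n + 1) =
      ((n + 1).factorial : ℂ) • (symm d (n + 1) * siteSum (n + 1) B) := by
    rw [Matrix.mul_assoc, siteSum_commute_symm, ← Matrix.mul_assoc, symm_mul_symm, Matrix.smul_mul]
  rw [Matrix.sum_apply]
  simp only [adjoin_conj_apply, h1, Matrix.smul_apply, smul_eq_mul, ← Finset.mul_sum,
    Matrix.add_apply]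
  congr 1
  simp only [Matrix.mul_apply (M := symm d (n + 1)), sum_cons, siteSum_cons, mul_add,
    Finset.sum_add_distrib, mul_ite, mul_zero, Finset.sum_ite_eq, Finset.mem_univ, if_true]
  congr 1
  · have h2 : ∀ c : Fin d, ∑ c', symm d (n + 1) (Fin.cons c v) (Fin.cons c' u) * B c' c =
      B c c * symm d n v u + ∑ i, B (v i) c * symm d n (Function.update v i c) u := by
      intro c
      simp only [symm_cons, add_mul, Finset.sum_add_distrib, ite_mul, zero_mul, Finset.sum_mul]
      rw [Finset.sum_comm]
      simp [mul_comm]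
    rw [Finset.sum_congr rfl fun c _ => h2 c, Finset.sum_add_distrib, Finset.sum_comm]
    simp only [siteSum, Finset.sum_mul, Matrix.sum_apply, site_mul_apply, Matrix.trace,
      Matrix.diag_apply]
  · have h3 : ∀ x : Fin d, (∑ x_1, ∑ x_2 : Fin n → Fin d, if x = x_1 then
        symm d (n + 1) (Fin.cons x v) (Fin.cons x_1 x_2) * siteSum n B x_2 u else 0) =
        ∑ w : Fin n → Fin d, symm d (n + 1) (Fin.cons x v) (Fin.cons x w) * siteSum n B w u := by
      intro x
      rw [Finset.sum_comm]
      simp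
    rw [Finset.sum_congr rfl fun x _ => h3 x, Finset.sum_comm]
    simp only [← Finset.sum_mul, symm_partialTrace]
    simp only [Matrix.mul_apply, Finset.mul_sum, mul_assoc]

/-- The sum over all systems of the fidelities with `ψ`. -/
def totalFidelity {d n : ℕ} (ψ : PureState d) (ρ : Op d n) : ℂ :=
  (ρ * siteSum n (proj ψ)).trace

lemma totalFidelity_stepMap {d n : ℕ} (hd : 1 ≤ d) (ψ : PureState d) {ρ : Op d n}
    (hρ : IsSymmetric ρ) (htr : ρ.trace = 1) :
    totalFidelity ψ (stepMap d n ρ) =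
      totalFidelity ψ ρ + (1 + totalFidelity ψ ρ) / (d + n) := by
  have hdn : (d + n : ℂ) ≠ 0 := by exact_mod_cast (by omega : d + n ≠ 0)
  have hn : (n.factorial : ℂ) ≠ 0 := by exact_mod_cast n.factorial_ne_zero
  have hn1 : ((n + 1).factorial : ℂ) ≠ 0 := by exact_mod_cast (n + 1).factorial_ne_zero
  have h : ∀ c, (conjMap (adjoin d n c) ρ * siteSum (n + 1) (proj ψ)).trace =
      (ρ * ((adjoin d n c).conjTranspose * siteSum (n + 1) (proj ψ) * adjoin d n c)).trace := by
    intro c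
    rw [conjMap_apply, Matrix.mul_assoc, Matrix.mul_assoc, Matrix.trace_mul_comm]
    simp only [Matrix.mul_assoc]
  have h2 : (ρ * (siteSum n (proj ψ) * symm d n)).trace = n.factorial * totalFidelity ψ ρ := by
    rw [siteSum_commute_symm, ← Matrix.mul_assoc, mul_symm_of_invariant hρ.2, Matrix.smul_mul,
      Matrix.trace_smul]
    rfl
  rw [totalFidelity, stepMap_apply_of_isSymmetric hρ, Matrix.smul_mul, Matrix.trace_smul,
    Finset.sum_mul, Matrix.trace_sum]
  simp_rw [h]
  rw [← Matrix.trace_sum, ← Finset.mul_sum, sum_adjoin_conj_siteSum]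
  simp only [Matrix.mul_smul, Matrix.mul_add, Matrix.trace_smul, Matrix.trace_add,
    ← siteSum_commute_symm, h2, mul_symm_of_invariant hρ.2, htr, trace_proj, smul_eq_mul]
  push_cast
  field_simp
  ring

lemma trace_copies {d : ℕ} (n : ℕ) (ψ : PureState d) : (copies n ψ).trace = 1 := by
  have := Finset.prod_univ_sum (fun _ : Fin n => (Finset.univ : Finset (Fin d)))
    (fun _ a => ψ.1 a * star (ψ.1 a))
  have h : ∑ a, ψ.1 a * star (ψ.1 a) = 1 := trace_proj ψ
  rw [Finset.prod_congr rfl fun i _ => h, Fintype.piFinset_univ] at this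
  simpa [Matrix.trace, copies] using this.symm

lemma copies_mul_site {d n : ℕ} (ψ : PureState d) (k : Fin n) :
    copies n ψ * site k (proj ψ) = copies n ψ := by
  ext a b
  have h : ∑ a, ψ.1 a * star (ψ.1 a) = 1 := trace_proj ψ
  rw [mul_site_apply]
  have : ∀ c, copies n ψ a (Function.update b k c) * proj ψ c (b k) =
      copies n ψ a b * (ψ.1 c * star (ψ.1 c)) := by
    intro c
    simp only [copies, proj]
    rw [← Finset.mul_prod_erase _ _ (Finset.mem_univ k),
      ← Finset.mul_prod_erase (a := k) (s := Finset.univ) (f := fun i => _ * star (ψ.1 (b i)))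
        (h := Finset.mem_univ k)]
    have e : ∏ x ∈ Finset.univ.erase k, ψ.1 (a x) * star (ψ.1 (Function.update b k c x)) =
        ∏ x ∈ Finset.univ.erase k, ψ.1 (a x) * star (ψ.1 (b x)) := by
      refine Finset.prod_congr rfl fun i hi => ?_
      rw [Function.update_of_ne (Finset.ne_of_mem_erase hi)]
    rw [e]
    simp only [Function.update_self]
    ring
  simp_rw [this]
  rw [← Finset.mul_sum, h, mul_one]

lemma totalFidelity_copies {d : ℕ} (n : ℕ) (ψ : PureState d) :
    totalFidelity ψ (copies n ψ) = n := by
  simp only [totalFidelity, siteSum, Finset.mul_sum, Matrix.trace_sum, copies_mul_site,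
    trace_copies]
  simp

/-- The recursion multiplies `1 + F` by `(d + n + 1)/(d + n)` for `n = N, …, N + m - 1`. The product
telescopes from `F = N` to `1 + F = (N + 1)(N + m + d)/(N + d)`. -/
lemma totalFidelity_iterateMap {d : ℕ} (hd : 1 ≤ d) (N m : ℕ) (ψ : PureState d) :
    totalFidelity ψ (iterateMap d N m (copies N ψ)) =
      (m + N * (N + m + d)) / (N + d) := by
  have hdn : (d + N : ℂ) ≠ 0 := by exact_mod_cast (by omega : d + N ≠ 0)
  induction m with
  | zero =>
    have : totalFidelity ψ (iterateMap d N 0 (copies N ψ)) = N := totalFidelity_copies N ψ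
    rw [this]
    rw [add_comm] at hdn
    field_simp
    simp
  | succ m ih =>
    have h := totalFidelity_stepMap (n := N + m) hd ψ
      (isSymmetric_iterateMap (isSymmetric_copies N ψ) m)
      (((universalCloner hd N m).trace_map _).trans (trace_copies N ψ))
    have h' : totalFidelity ψ (iterateMap d N (m + 1) (copies N ψ)) = _ := h
    rw [h', ih]
    have hdm : (d + (N + m) : ℂ) ≠ 0 := by exact_mod_cast (by omega : d + (N + m) ≠ 0)
    rw [add_comm] at hdn
    push_cast
    field_simp
    ring

lemma Cloner.sum_cloneFidelity {d N M : ℕ} (L : Cloner d N M) (ψ : PureState d) :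
    ∑ k, L.cloneFidelity k ψ = (totalFidelity ψ (L.toMap (copies N ψ))).re := by
  simp only [Cloner.cloneFidelity, fidelity_reduced, totalFidelity, siteSum, Finset.mul_sum,
    Matrix.trace_sum, Complex.re_sum]

lemma universalCloner_cloneFidelity {d : ℕ} (hd : 1 ≤ d) {N : ℕ} (hN : 1 ≤ N) (m : ℕ)
    (k : Fin (N + m)) (ψ : PureState d) :
    (universalCloner hd N m).cloneFidelity k ψ =
      (m + N * (N + m + d)) / ((N + m) * (N + d)) := by
  have h := (universalCloner hd N m).sum_cloneFidelity ψ
  have h1 : ∀ l, (universalCloner hd N m).cloneFidelity l ψ =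
      (universalCloner hd N m).cloneFidelity k ψ := by
    intro l
    unfold Cloner.cloneFidelity
    congr 1
    exact reduced_eq_of_isSymmetric (isSymmetric_iterateMap (isSymmetric_copies N ψ) m) l k
  have h2 : (totalFidelity ψ ((universalCloner hd N m).toMap (copies N ψ))).re =
      (m + N * (N + m + d)) / (N + d) := by
    have := totalFidelity_iterateMap hd N m ψ
    change (totalFidelity ψ (iterateMap d N m (copies N ψ))).re = _
    rw [this]
    have e : ((m + N * (N + m + d)) / (N + d) : ℂ) =
        ((m + N * (N + m + d)) / (N + d) : ℝ) := by push_cast; rfl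
    rw [e, Complex.ofReal_re]
  rw [h2, Finset.sum_congr rfl fun l _ => h1 l] at h
  simp only [Finset.sum_const, Finset.card_univ, Fintype.card_fin, nsmul_eq_mul] at h
  have hNm : (N + m : ℝ) ≠ 0 := by exact_mod_cast (by omega : N + m ≠ 0)
  have hNd : (N + d : ℝ) ≠ 0 := by exact_mod_cast (by omega : N + d ≠ 0)
  push_cast at h
  field_simp at h ⊢
  linarith

lemma universalCloner_isUniversal {d : ℕ} (hd : 1 ≤ d) {N : ℕ} (hN : 1 ≤ N) (m : ℕ) :
    (universalCloner hd N m).IsUniversal := by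
  refine ⟨fun ψ k l => ?_, fun k ψ φ => ?_⟩
  · exact reduced_eq_of_isSymmetric (isSymmetric_iterateMap (isSymmetric_copies N ψ) m) k l
  · rw [universalCloner_cloneFidelity hd hN, universalCloner_cloneFidelity hd hN]

/-! ### The contraction inequality -/

/-- As `f` ignores the letter at `k`, exactly one of the `d` choices of that letter agrees with the
letter at `l`. -/
lemma sum_ite_eq_letter {d M : ℕ} {k l : Fin M} (h : l ≠ k) (f : (Fin M → Fin d) → ℝ)
    (hf : ∀ x c, f (Function.update x k c) = f x) :
    (d : ℝ) * ∑ x, (if x k = x l then f x else 0) = ∑ x, f x := by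
  rw [← nsmul_eq_mul, ← sum_update_const k]
  refine Finset.sum_congr rfl fun x _ => ?_
  simp [Function.update_of_ne h, hf]

/-- Contracting an external system with each of `M` systems in turn. -/
lemma sum_contraction_le {d M : ℕ} (v : Fin d → (Fin M → Fin d) → ℂ) :
    ∑ k, ∑ x, ‖∑ c, v c (Function.update x k c)‖ ^ 2 ≤
      d * ((M : ℝ) + d - 1) * ∑ c, ∑ x, ‖v c x‖ ^ 2 := by
  rcases Nat.eq_zero_or_pos d with rfl | hd
  · simp
  have hd1 : (1 : ℝ) ≤ d := by exact_mod_cast hd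
  set w : Fin M → (Fin M → Fin d) → ℂ := fun k x => ∑ c, v c (Function.update x k c) with hw
  set t : ℝ := ∑ k, ∑ x, ‖w k x‖ ^ 2 with ht
  set V : ℝ := ∑ c, ∑ x, ‖v c x‖ ^ 2 with hV
  have ht0 : 0 ≤ t := by positivity
  have hV0 : 0 ≤ V := by positivity
  have hwu : ∀ k x c, w k (Function.update x k c) = w k x := by
    intro k x c
    simp [hw]
  -- Up to the factor `d`, `u` is the adjoint of the contraction applied to `w`. Hence `t = d ⟨u,
  -- v⟩`, and Cauchy–Schwarz reduces the claim to a bound on the norm of `u` by `t` itself.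
  set u : Fin d → (Fin M → Fin d) → ℂ := fun c x => ∑ k, if c = x k then w k x else 0 with hu
  set U : ℝ := ∑ c, ∑ x, ‖u c x‖ ^ 2 with hU
  have hU_le : d * U ≤ ((M : ℝ) + d - 1) * t := by
    have h1 : U ≤ ∑ k, ∑ l, ∑ x, if x k = x l then ‖w k x‖ ^ 2 else 0 := by
      have h2 : ∀ c x, ‖u c x‖ ^ 2 ≤ ∑ k, ∑ l, if c = x k ∧ c = x l then
          (‖w k x‖ ^ 2 + ‖w l x‖ ^ 2) / 2 else 0 := by
        intro c x
        have h3 : ‖u c x‖ ≤ ∑ k, if c = x k then ‖w k x‖ else 0 := by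
          refine (norm_sum_le _ _).trans (Finset.sum_le_sum fun k _ => ?_)
          split_ifs <;> simp
        calc ‖u c x‖ ^ 2 ≤ (∑ k, if c = x k then ‖w k x‖ else 0) ^ 2 := by gcongr
          _ = ∑ k, ∑ l, (if c = x k then ‖w k x‖ else 0) * (if c = x l then ‖w l x‖ else 0) := by
            rw [sq, Finset.sum_mul_sum]
          _ ≤ _ := by
            refine Finset.sum_le_sum fun k _ => Finset.sum_le_sum fun l _ => ?_
            by_cases h4 : c = x k
            · by_cases h5 : c = x l
              · rw [if_pos h4, if_pos h5, if_pos ⟨h4, h5⟩]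
                nlinarith [sq_nonneg (‖w k x‖ - ‖w l x‖)]
              · rw [if_neg h5, mul_zero, if_neg fun h => h5 h.2]
            · rw [if_neg h4, zero_mul, if_neg fun h => h4 h.1]
      have h6 : ∀ x, ∑ c, ∑ k, ∑ l, (if c = x k ∧ c = x l then
          (‖w k x‖ ^ 2 + ‖w l x‖ ^ 2) / 2 else 0) =
          ∑ k, ∑ l, if x k = x l then ‖w k x‖ ^ 2 else 0 := by
        intro x
        have h7 : ∑ c, ∑ k, ∑ l, (if c = x k ∧ c = x l then
            (‖w k x‖ ^ 2 + ‖w l x‖ ^ 2) / 2 else 0) =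
            ∑ k, ∑ l, if x k = x l then (‖w k x‖ ^ 2 + ‖w l x‖ ^ 2) / 2 else 0 := by
          rw [Finset.sum_comm]
          refine Finset.sum_congr rfl fun k _ => ?_
          rw [Finset.sum_comm]
          refine Finset.sum_congr rfl fun l _ => ?_
          simp [ite_and]
        have h8 : ∑ k, ∑ l, (if x k = x l then ‖w l x‖ ^ 2 else 0) =
            ∑ k, ∑ l, if x k = x l then ‖w k x‖ ^ 2 else 0 := by
          rw [Finset.sum_comm]
          simp_rw [eq_comm]
        have h9 : ∀ k l, (if x k = x l then (‖w k x‖ ^ 2 + ‖w l x‖ ^ 2) / 2 else 0) =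
            ((if x k = x l then ‖w k x‖ ^ 2 else 0) + if x k = x l then ‖w l x‖ ^ 2 else 0) / 2 := by
          intro k l
          split_ifs <;> simp
        rw [h7]
        simp_rw [h9, ← Finset.sum_div, Finset.sum_add_distrib]
        rw [h8]
        ring
      calc U = ∑ x, ∑ c, ‖u c x‖ ^ 2 := Finset.sum_comm
        _ ≤ ∑ x, ∑ c, ∑ k, ∑ l, if c = x k ∧ c = x l then
          (‖w k x‖ ^ 2 + ‖w l x‖ ^ 2) / 2 else 0 :=
            Finset.sum_le_sum fun x _ => Finset.sum_le_sum fun c _ => h2 c x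
        _ = ∑ x, ∑ k, ∑ l, if x k = x l then ‖w k x‖ ^ 2 else 0 :=
            Finset.sum_congr rfl fun x _ => h6 x
        _ = _ := by
            rw [Finset.sum_comm]
            exact Finset.sum_congr rfl fun k _ => Finset.sum_comm
    -- The pair `k = l` counts with weight `d` and each of the `M - 1` pairs `l ≠ k` with weight
    -- `1`, which gives the constant `M + d - 1`.
    have h10 : ∀ k l, (d : ℝ) * ∑ x, (if x k = x l then ‖w k x‖ ^ 2 else 0) =
        (1 + if l = k then (d : ℝ) - 1 else 0) * ∑ x, ‖w k x‖ ^ 2 := by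
      intro k l
      by_cases hlk : l = k
      · subst hlk; simp
      · rw [sum_ite_eq_letter hlk]
        · simp [hlk]
        · intro x c; rw [hwu]
    calc (d : ℝ) * U ≤ d * ∑ k, ∑ l, ∑ x, (if x k = x l then ‖w k x‖ ^ 2 else 0) := by gcongr
      _ = ∑ k, ∑ l, (1 + if l = k then (d : ℝ) - 1 else 0) * ∑ x, ‖w k x‖ ^ 2 := by
        rw [Finset.mul_sum]
        refine Finset.sum_congr rfl fun k _ => ?_
        rw [Finset.mul_sum]
        exact Finset.sum_congr rfl fun l _ => h10 k l
      _ = ∑ k, ((M : ℝ) + d - 1) * ∑ x, ‖w k x‖ ^ 2 := by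
        refine Finset.sum_congr rfl fun k _ => ?_
        rw [← Finset.sum_mul, Finset.sum_add_distrib]
        simp [add_sub_assoc]
      _ = _ := by rw [← Finset.mul_sum]
  have ht_le : t ≤ d * ∑ c, ∑ x, ‖u c x‖ * ‖v c x‖ := by
    have h1 : ((t : ℝ) : ℂ) = d * ∑ c, ∑ x, star (u c x) * v c x := by
      have h2 : ∑ c, ∑ x, star (u c x) * v c x = ∑ k, ∑ x, star (w k x) * v (x k) x := by
        rw [Finset.sum_comm, Finset.sum_comm (s := (Finset.univ : Finset (Fin M)))]
        refine Finset.sum_congr rfl fun x _ => ?_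
        simp only [hu, star_sum, Finset.sum_mul]
        rw [Finset.sum_comm]
        refine Finset.sum_congr rfl fun k _ => ?_
        simp [apply_ite]
      rw [h2, Finset.mul_sum, ht]
      push_cast
      refine Finset.sum_congr rfl fun k _ => ?_
      rw [← nsmul_eq_mul, ← sum_update_const k]
      refine Finset.sum_congr rfl fun x _ => ?_
      simp only [hwu, Function.update_self]
      rw [← Finset.mul_sum]
      change _ = star (w k x) * w k x
      rw [mul_comm]
      simp [Complex.mul_conj, Complex.normSq_eq_norm_sq]
    have h3 : t = ‖((t : ℝ) : ℂ)‖ := by simp [abs_of_nonneg ht0]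
    rw [h3, h1, norm_mul, Complex.norm_natCast]
    gcongr
    refine (norm_sum_le _ _).trans (Finset.sum_le_sum fun c _ => ?_)
    refine (norm_sum_le _ _).trans (Finset.sum_le_sum fun x _ => ?_)
    simp
  have hcs : (∑ c, ∑ x, ‖u c x‖ * ‖v c x‖) ^ 2 ≤ U * V := by
    simp only [hU, hV, ← Fintype.sum_prod_type']
    exact Finset.sum_mul_sq_le_sq_mul_sq _ _ _
  have hsq : t ^ 2 ≤ d * ((M : ℝ) + d - 1) * V * t := by
    calc t ^ 2 ≤ (d * ∑ c, ∑ x, ‖u c x‖ * ‖v c x‖) ^ 2 := by gcongr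
      _ = d ^ 2 * (∑ c, ∑ x, ‖u c x‖ * ‖v c x‖) ^ 2 := by ring
      _ ≤ d ^ 2 * (U * V) := by gcongr
      _ = d * (d * U) * V := by ring
      _ ≤ d * (((M : ℝ) + d - 1) * t) * V := by gcongr
      _ = _ := by ring
  have hM : (0 : ℝ) ≤ (M : ℝ) + d - 1 := by
    have : (0 : ℝ) ≤ M := by positivity
    linarith
  rcases ht0.eq_or_lt with h0 | h0
  · rw [← h0]; positivity
  · rw [sq] at hsq
    exact le_of_mul_le_mul_right hsq h0

/-! ### Kraus operators -/

/-- Choi's argument: the amplified map sends the positive operator of the unnormalised maximally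
entangled vector `w` to a positive matrix that contains all values of `Φ` on matrix units. Its
rank-one decomposition, reshaped, gives the Kraus operators. -/
lemma IsCompletelyPositive.exists_kraus {m n : Type} [Fintype m] [DecidableEq m] [Finite n]
    {Φ : Matrix m m ℂ →ₗ[ℂ] Matrix n n ℂ} (hΦ : IsCompletelyPositive Φ) :
    ∃ (s : ℕ) (A : Fin s → Matrix n m ℂ), Φ = ∑ j, conjMap (A j) := by
  let e := Fintype.equivFin m
  let w : m × Fin (Fintype.card m) → ℂ := fun p => if p.2 = e p.1 then 1 else 0
  have h := hΦ _ _ (Matrix.posSemidef_vecMulVec_self_star w)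
  obtain ⟨s, v, hv⟩ := Matrix.posSemidef_iff_eq_sum_vecMulVec.mp h
  refine ⟨s, fun j => Matrix.of fun x a => v j (x, e a), ?_⟩
  refine Matrix.ext_linearMap _ fun a b => ?_
  ext x y
  have h1 := congrFun (congrFun hv (x, e a)) (y, e b)
  have h2 : (fun a' b' => Matrix.vecMulVec w (star w) (a', e a) (b', e b)) =
      Matrix.single a b (1 : ℂ) := by
    ext a' b'
    simp only [Matrix.vecMulVec_apply, Pi.star_apply, w, Matrix.single_apply, EmbeddingLike.apply_eq_iff_eq]
    by_cases h3 : a = a' <;> by_cases h4 : b = b' <;> simp [h3, h4]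
  simp only [amplify, h2] at h1
  simp only [LinearMap.comp_apply, Matrix.singleLinearMap_apply]
  rw [h1]
  simp only [Matrix.sum_apply, LinearMap.sum_apply, Matrix.vecMulVec_apply, Pi.star_apply]
  refine Finset.sum_congr rfl fun j _ => ?_
  simp [conjMap_apply, Matrix.mul_apply, Matrix.single_apply, ite_and, Finset.sum_ite_eq]

/-- Kraus operators for the restriction of a cloner to the symmetric subspace. -/
lemma Cloner.exists_symmetric_kraus {d N M : ℕ} (L : Cloner d N M) :
    ∃ (s : ℕ) (B : Fin s → Matrix (Fin M → Fin d) (Fin N → Fin d) ℂ),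
      (∀ X, IsSymmetric X → L.toMap X = ∑ j, B j * X * (B j).conjTranspose) ∧
      (∀ j x a (σ : Equiv.Perm (Fin N)), B j x (a ∘ σ) = B j x a) ∧
      ∑ j, ∑ x, ∑ a, ‖B j x a‖ ^ 2 = symmTrace d N / N.factorial := by
  obtain ⟨s, A, hA⟩ := L.completelyPositive.exists_kraus
  have hn : (N.factorial : ℂ) ≠ 0 := by exact_mod_cast N.factorial_ne_zero
  set P : Op d N := (N.factorial : ℂ)⁻¹ • symm d N with hP
  have hPs : P.conjTranspose = P := by
    rw [hP, Matrix.conjTranspose_smul, symm_isHermitian]; simp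
  have hPP : P * P = P := by
    simp only [hP, Matrix.smul_mul, Matrix.mul_smul, symm_mul_symm, smul_smul]
    rw [inv_mul_cancel₀ hn, mul_one]
  have hPX : ∀ X : Op d N, IsSymmetric X → P * X * P = X := by
    intro X hX
    simp only [hP, Matrix.smul_mul, Matrix.mul_smul, symm_mul_of_invariant hX.1,
      mul_symm_of_invariant hX.2, smul_smul]
    simp [hn]
  have hLA : ∀ X, L.toMap X = ∑ j, A j * X * (A j).conjTranspose := by
    intro X; rw [hA]; simp [conjMap_apply]
  refine ⟨s, fun j => A j * P, fun X hX => ?_, fun j x a σ => ?_, ?_⟩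
  · rw [hLA]
    refine Finset.sum_congr rfl fun j _ => ?_
    conv_lhs => rw [← hPX X hX]
    rw [Matrix.conjTranspose_mul, hPs]
    simp only [Matrix.mul_assoc]
  · simp only [Matrix.mul_apply, hP, Matrix.smul_apply, symm_comp_right]
  · have h1 : ∀ (B : Matrix (Fin M → Fin d) (Fin N → Fin d) ℂ),
        ((∑ x, ∑ a, ‖B x a‖ ^ 2 : ℝ) : ℂ) = (B * B.conjTranspose).trace := by
      intro B
      simp [Matrix.trace, Matrix.mul_apply, Complex.mul_conj, Complex.normSq_eq_norm_sq]
    -- The left side is the trace of the image of `P`, so trace preservation gives the total norm.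
    have h2 : ((∑ j, ∑ x, ∑ a, ‖(A j * P) x a‖ ^ 2 : ℝ) : ℂ) = P.trace := by
      rw [Complex.ofReal_sum]
      simp_rw [h1]
      rw [← L.trace_map P, hLA, Matrix.trace_sum]
      refine Finset.sum_congr rfl fun j _ => ?_
      rw [Matrix.conjTranspose_mul, hPs]
      conv_rhs => rw [← hPP]
      simp only [Matrix.mul_assoc]
    have h3 : P.trace = ((symmTrace d N / N.factorial : ℝ) : ℂ) := by
      rw [hP, Matrix.trace_smul, trace_symm]
      push_cast
      rw [smul_eq_mul]
      field_simp
    exact_mod_cast h2.trans h3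

/-! ### The upper bound for uniformly distributed inputs -/

/-- Expanding by `symm_cons`, the term with `c = e` gives the norm of `u`, and the term for `i`
pairs `u a (a i)` with `u (update a i c) c`. The factor `d` frees the letter `a i`, which turns this
pairing into the squared norm of a contraction. The remaining permutations act trivially on `u` and
contribute `N!`. -/
lemma sum_mul_symm_cons {d N : ℕ} (u : (Fin N → Fin d) → Fin d → ℂ)
    (hu : ∀ a c (σ : Equiv.Perm (Fin N)), u (a ∘ σ) c = u a c) :
    (d : ℂ) * ∑ a, ∑ b, ∑ c, ∑ e,
      u a e * star (u b c) * symm d (N + 1) (Fin.cons c a) (Fin.cons e b) =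
      ((N.factorial * (d * ∑ a, ∑ c, ‖u a c‖ ^ 2 +
        ∑ i, ∑ a, ‖∑ e, u (Function.update a i e) e‖ ^ 2) : ℝ) : ℂ) := by
  have h1 : ∀ x c, ∑ b, star (u b c) * symm d N x b = N.factorial * star (u x c) := by
    intro x c
    have := congrFun (congrFun (symm_mul_of_invariant (X := fun b c => star (u b c))
      (fun a b σ => by rw [hu])) x) c
    change ∑ b, symm d N x b * star (u b c) = N.factorial * star (u x c) at this
    rw [← this]
    exact Finset.sum_congr rfl fun b _ => mul_comm _ _
  have h2 : ∀ a, ∑ b, ∑ c, ∑ e,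
      u a e * star (u b c) * symm d (N + 1) (Fin.cons c a) (Fin.cons e b) =
      N.factorial * (∑ c, u a c * star (u a c) +
        ∑ i, ∑ c, u a (a i) * star (u (Function.update a i c) c)) := by
    intro a
    rw [Finset.sum_comm, mul_add, Finset.mul_sum,
      Finset.sum_comm (s := (Finset.univ : Finset (Fin N))), Finset.mul_sum,
      ← Finset.sum_add_distrib]
    refine Finset.sum_congr rfl fun c _ => ?_
    have h3 : ∀ b, ∑ e, u a e * star (u b c) * symm d (N + 1) (Fin.cons c a) (Fin.cons e b) =
        u a c * (star (u b c) * symm d N a b) +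
        ∑ i, u a (a i) * (star (u b c) * symm d N (Function.update a i c) b) := by
      intro b
      simp only [symm_cons, mul_add, Finset.sum_add_distrib, mul_ite, mul_zero, Finset.mul_sum]
      rw [Finset.sum_comm (s := (Finset.univ : Finset (Fin d)))]
      simp [mul_assoc]
    rw [Finset.sum_congr rfl fun b _ => h3 b, Finset.sum_add_distrib, Finset.sum_comm]
    simp only [← Finset.mul_sum, h1]
    rw [Finset.mul_sum]
    congr 1
    · ring
    · exact Finset.sum_congr rfl fun i _ => by ring
  rw [Finset.sum_congr rfl fun a _ => h2 a, ← Finset.mul_sum, Finset.sum_add_distrib]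
  have h4 : (d : ℂ) * ∑ a, ∑ i, ∑ c, u a (a i) * star (u (Function.update a i c) c) =
      ∑ i, ∑ a, (‖∑ e, u (Function.update a i e) e‖ ^ 2 : ℂ) := by
    rw [Finset.sum_comm, Finset.mul_sum]
    refine Finset.sum_congr rfl fun i _ => ?_
    rw [← nsmul_eq_mul, ← sum_update_const i]
    refine Finset.sum_congr rfl fun a _ => ?_
    simp only [Function.update_self, Function.update_idem, ← Finset.mul_sum]
    rw [← Finset.sum_mul, ← star_sum]
    exact Complex.mul_conj' _
  have h5 : ∑ a, ∑ c, u a c * star (u a c) = ∑ a, ∑ c, (‖u a c‖ ^ 2 : ℂ) := by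
    simp [Complex.mul_conj']
  rw [h5, mul_left_comm, mul_add, h4]
  push_cast
  rfl

lemma sum_reverse {α β γ δ E : Type*} [Fintype α] [Fintype β] [Fintype γ] [Fintype δ]
    [AddCommMonoid E] (F : α → β → γ → δ → E) :
    ∑ a, ∑ b, ∑ c, ∑ e, F a b c e = ∑ e, ∑ c, ∑ b, ∑ a, F a b c e := by
  have h1 : ∀ a, ∑ b, ∑ c, ∑ e, F a b c e = ∑ e, ∑ c, ∑ b, F a b c e := by
    intro a
    rw [Finset.sum_congr rfl fun b _ => Finset.sum_comm, Finset.sum_comm]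
    exact Finset.sum_congr rfl fun e _ => Finset.sum_comm
  rw [Finset.sum_congr rfl fun a _ => h1 a, Finset.sum_comm]
  refine Finset.sum_congr rfl fun e _ => ?_
  rw [Finset.sum_comm]
  exact Finset.sum_congr rfl fun c _ => Finset.sum_comm

/-- The projection tested on the `k`-th clone joins the `N` input copies to form `N + 1` copies, so
averaging over inputs needs only the moment of order `N + 1`. The factor `d` frees the letter at
`k`. -/
lemma trace_mul_site {d N M : ℕ} (B : Matrix (Fin M → Fin d) (Fin N → Fin d) ℂ) (ψ : PureState d)
    (k : Fin M) :
    (d : ℂ) * (B * copies N ψ * B.conjTranspose * site k (proj ψ)).trace =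
      ∑ x, ∑ a, ∑ b, ∑ c, ∑ e, B (Function.update x k e) a * star (B (Function.update x k c) b) *
        copies (N + 1) ψ (Fin.cons c a) (Fin.cons e b) := by
  rw [Matrix.trace, ← nsmul_eq_mul, ← sum_update_const k]
  refine Finset.sum_congr rfl fun x _ => ?_
  have h : ∀ c e a b, copies (N + 1) ψ (Fin.cons c a) (Fin.cons e b) =
      ψ.1 c * star (ψ.1 e) * copies N ψ a b := by
    intro c e a b
    simp [copies, Fin.prod_univ_succ]
  simp only [h, Matrix.diag_apply, mul_site_apply, Function.update_idem, Function.update_self]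
  simp only [Matrix.mul_apply, Finset.sum_mul, Matrix.conjTranspose_apply, proj]
  rw [sum_reverse]
  refine Finset.sum_congr rfl fun a _ => Finset.sum_congr rfl fun b _ =>
    Finset.sum_congr rfl fun c _ => Finset.sum_congr rfl fun e _ => ?_
  ring

lemma integrable_of_continuous {d : ℕ} {E : Type*} [NormedAddCommGroup E]
    {μ : Measure (PureState d)} [IsFiniteMeasure μ] {f : PureState d → E} (hf : Continuous f) :
    Integrable f μ :=
  hf.integrable_of_hasCompactSupport (HasCompactSupport.of_compactSpace f)

lemma continuous_copies {d : ℕ} (n : ℕ) : Continuous fun ψ : PureState d => copies n ψ := by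
  refine continuous_pi fun a => continuous_pi fun b => ?_
  unfold copies
  fun_prop

lemma integral_trace_mul_site {d N M : ℕ} {μ : Measure (PureState d)} [IsFiniteMeasure μ]
    (hμ : ∀ n a b, ∫ ψ, copies n ψ a b ∂μ = symm d n a b / symmTrace d n)
    (B : Matrix (Fin M → Fin d) (Fin N → Fin d) ℂ)
    (hB : ∀ x a (σ : Equiv.Perm (Fin N)), B x (a ∘ σ) = B x a) (k : Fin M) :
    (d : ℂ) ^ 2 * ∫ ψ, (B * copies N ψ * B.conjTranspose * site k (proj ψ)).trace ∂μ =
      ((N.factorial / symmTrace d (N + 1) * ∑ x,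
        (d * ∑ a, ∑ c, ‖B (Function.update x k c) a‖ ^ 2 +
        ∑ i, ∑ a, ‖∑ e, B (Function.update x k e) (Function.update a i e)‖ ^ 2) : ℝ) : ℂ) := by
  have hint : ∀ (z : ℂ) (a b : Fin (N + 1) → Fin d),
      Integrable (fun ψ => z * copies (N + 1) ψ a b) μ := fun z a b =>
    (integrable_of_continuous (((continuous_copies (N + 1)).matrix_elem a b))).const_mul z
  have h1 : (d : ℂ) * ∫ ψ, (B * copies N ψ * B.conjTranspose * site k (proj ψ)).trace ∂μ =
      (∑ x, ∑ a, ∑ b, ∑ c, ∑ e, B (Function.update x k e) a *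
        star (B (Function.update x k c) b) *
        symm d (N + 1) (Fin.cons c a) (Fin.cons e b)) / symmTrace d (N + 1) := by
    rw [← integral_const_mul]
    simp_rw [trace_mul_site]
    simp only [Finset.sum_div]
    rw [integral_finsetSum _ fun x _ => ?_]
    on_goal 1 => refine Finset.sum_congr rfl fun x _ => ?_
    on_goal 1 => rw [integral_finsetSum _ fun a _ => ?_]
    on_goal 1 => refine Finset.sum_congr rfl fun a _ => ?_
    on_goal 1 => rw [integral_finsetSum _ fun b _ => ?_]
    on_goal 1 => refine Finset.sum_congr rfl fun b _ => ?_
    on_goal 1 => rw [integral_finsetSum _ fun c _ => ?_]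
    on_goal 1 => refine Finset.sum_congr rfl fun c _ => ?_
    on_goal 1 => rw [integral_finsetSum _ fun e _ => ?_]
    on_goal 1 => refine Finset.sum_congr rfl fun e _ => ?_
    · rw [integral_const_mul, hμ, mul_div_assoc]
    all_goals
      repeat' refine integrable_finsetSum _ fun _ _ => ?_
      exact hint _ _ _
  rw [sq, mul_assoc, h1, mul_div_assoc', Finset.mul_sum]
  simp_rw [fun x => sum_mul_symm_cons (fun a c => B (Function.update x k c) a)
    (fun a c σ => hB _ a σ)]
  push_cast
  rw [Finset.mul_sum, Finset.sum_div]
  refine Finset.sum_congr rfl fun x _ => ?_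
  ring

/-- Any cloner is bounded by the optimal universal one if the input distribution has the moments
of the uniform distribution. -/
lemma Cloner.avgFidelity_le_of_moments {d N M : ℕ} (hd : 1 ≤ d) (hM : 1 ≤ M)
    {μ : Measure (PureState d)} [IsFiniteMeasure μ]
    (hμ : ∀ n a b, ∫ ψ, copies n ψ a b ∂μ = symm d n a b / symmTrace d n)
    (L : Cloner d N M) :
    L.avgFidelity μ ≤ ((M : ℝ) - N + N * (M + d)) / (M * (N + d)) := by
  have hd1 : (1 : ℝ) ≤ d := by exact_mod_cast hd
  have hM1 : (1 : ℝ) ≤ M := by exact_mod_cast hM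
  have hN0 : (0 : ℝ) ≤ N := by positivity
  obtain ⟨s, B, hLB, hB, hBn⟩ := L.exists_symmetric_kraus
  set V : Fin s → ℝ := fun j => ∑ x, ∑ a, ‖B j x a‖ ^ 2 with hV
  have hτ := symmTrace_pos hd (N + 1)
  have hcont : ∀ j k, Continuous fun ψ : PureState d =>
      (B j * copies N ψ * (B j).conjTranspose * site k (proj ψ)).trace := by
    intro j k
    have h1 : Continuous fun ψ : PureState d => (site k (proj ψ) : Op d M) := by
      refine continuous_pi fun x => continuous_pi fun y => ?_
      unfold site proj
      split_ifs
      · fun_prop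
      · fun_prop
    have h2 := continuous_copies (d := d) N
    exact (((continuous_const.matrix_mul h2).matrix_mul continuous_const).matrix_mul
      h1).matrix_trace
  have h1 : L.avgFidelity μ = (1 / M) * ∑ j, ∑ k,
      (∫ ψ, (B j * copies N ψ * (B j).conjTranspose * site k (proj ψ)).trace ∂μ).re := by
    unfold Cloner.avgFidelity
    simp_rw [integral_const_mul]
    rw [← Finset.mul_sum, Finset.sum_comm]
    congr 1
    refine Finset.sum_congr rfl fun k _ => ?_
    rw [← Complex.re_sum, ← integral_finsetSum _ fun j _ => integrable_of_continuous (hcont j k)]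
    have h2 : ∀ ψ, L.cloneFidelity k ψ =
        (∑ j, (B j * copies N ψ * (B j).conjTranspose * site k (proj ψ)).trace).re := by
      intro ψ
      rw [Cloner.cloneFidelity, fidelity_reduced, hLB _ (isSymmetric_copies N ψ),
        Finset.sum_mul, Matrix.trace_sum]
    simp_rw [h2]
    exact integral_re (integrable_of_continuous (continuous_finsetSum _ fun j _ => hcont j k))
  have h3 : ∀ j k, (d : ℝ) ^ 2 *
      (∫ ψ, (B j * copies N ψ * (B j).conjTranspose * site k (proj ψ)).trace ∂μ).re =
      N.factorial / symmTrace d (N + 1) * ∑ x,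
        (d * ∑ a, ∑ c, ‖B j (Function.update x k c) a‖ ^ 2 +
        ∑ i, ∑ a, ‖∑ e, B j (Function.update x k e) (Function.update a i e)‖ ^ 2) := by
    intro j k
    rw [← Complex.ofReal_re (N.factorial / symmTrace d (N + 1) * _),
      ← integral_trace_mul_site hμ (B j) (hB j) k]
    have : (d : ℂ) ^ 2 = ((d ^ 2 : ℝ) : ℂ) := by push_cast; rfl
    rw [this, Complex.re_ofReal_mul]
  have h4 : ∀ j, ∑ k, ∑ x, (d * ∑ a, ∑ c, ‖B j (Function.update x k c) a‖ ^ 2 +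
        ∑ i, ∑ a, ‖∑ e, B j (Function.update x k e) (Function.update a i e)‖ ^ 2) ≤
      d ^ 2 * (M + N * (M + d - 1)) * V j := by
    intro j
    have h5 : ∀ k : Fin M, ∑ x, ∑ a, ∑ c, ‖B j (Function.update x k c) a‖ ^ 2 = d * V j := by
      intro k
      rw [hV, ← nsmul_eq_mul, ← sum_update_const k]
      exact Finset.sum_congr rfl fun x _ => Finset.sum_comm
    -- The contraction inequality is applied to the output index for each fixed input word `a`.
    -- Summing over `a` repeats every word `d` times, hence `d ^ 2`.
    have h6 : ∀ i : Fin N, ∑ k, ∑ x, ∑ a,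
        ‖∑ e, B j (Function.update x k e) (Function.update a i e)‖ ^ 2 ≤
        d ^ 2 * (M + d - 1) * V j := by
      intro i
      calc ∑ k, ∑ x, ∑ a, ‖∑ e, B j (Function.update x k e) (Function.update a i e)‖ ^ 2
          = ∑ a, ∑ k, ∑ x, ‖∑ e, B j (Function.update x k e) (Function.update a i e)‖ ^ 2 := by
            rw [Finset.sum_comm (s := (Finset.univ : Finset (Fin N → Fin d)))]
            exact Finset.sum_congr rfl fun k _ => Finset.sum_comm
        _ ≤ ∑ a, d * ((M : ℝ) + d - 1) * ∑ e, ∑ x, ‖B j x (Function.update a i e)‖ ^ 2 :=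
            Finset.sum_le_sum fun a _ =>
              sum_contraction_le fun e x => B j x (Function.update a i e)
        _ = d * ((M : ℝ) + d - 1) * (d * V j) := by
            rw [← Finset.mul_sum,
              sum_update_const i (fun a => ∑ x, ‖B j x a‖ ^ 2), nsmul_eq_mul, Finset.sum_comm]
        _ = _ := by ring
    have h7 : ∑ k, ∑ x, ∑ i, ∑ a,
        ‖∑ e, B j (Function.update x k e) (Function.update a i e)‖ ^ 2 =
        ∑ i, ∑ k, ∑ x, ∑ a,
        ‖∑ e, B j (Function.update x k e) (Function.update a i e)‖ ^ 2 := by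
      rw [Finset.sum_comm (s := (Finset.univ : Finset (Fin N)))]
      exact Finset.sum_congr rfl fun k _ => Finset.sum_comm
    have h8 := Finset.sum_le_sum fun i (_ : i ∈ Finset.univ) => h6 i
    simp only [Finset.sum_add_distrib, ← Finset.mul_sum, h5, h7]
    simp only [Finset.sum_const, Finset.card_univ, Fintype.card_fin, nsmul_eq_mul] at h8 ⊢
    linarith
  have h9 : ∑ j, ∑ k,
      (∫ ψ, (B j * copies N ψ * (B j).conjTranspose * site k (proj ψ)).trace ∂μ).re ≤
      ((M : ℝ) + N * (M + d - 1)) / (N + d) := by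
    have h10 : ∀ j, ∑ k,
        (∫ ψ, (B j * copies N ψ * (B j).conjTranspose * site k (proj ψ)).trace ∂μ).re ≤
        N.factorial / symmTrace d (N + 1) * ((M + N * (M + d - 1)) * V j) := by
      intro j
      have hd2 : (0 : ℝ) < d ^ 2 := by positivity
      refine le_of_mul_le_mul_left ?_ hd2
      rw [Finset.mul_sum]
      simp_rw [h3]
      rw [← Finset.mul_sum]
      calc _ ≤ N.factorial / symmTrace d (N + 1) * (d ^ 2 * (M + N * (M + d - 1)) * V j) :=
            mul_le_mul_of_nonneg_left (h4 j) (by positivity)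
        _ = _ := by ring
    -- The total norm `symmTrace d N / N!` of the Kraus operators cancels the prefactor up to the
    -- ratio of consecutive `symmTrace`, leaving `1 / (d + N)`.
    refine (Finset.sum_le_sum fun j _ => h10 j).trans (le_of_eq ?_)
    rw [← Finset.mul_sum, ← Finset.mul_sum, hBn]
    have h11 : symmTrace d (N + 1) = symmTrace d N * (d + N) := by
      simp [symmTrace, Finset.prod_range_succ]
    have h12 := (symmTrace_pos hd N).ne'
    have h13 : (N.factorial : ℝ) ≠ 0 := by exact_mod_cast N.factorial_ne_zero
    have h14 : (d + N : ℝ) ≠ 0 := by positivity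
    rw [h11]
    rw [add_comm (N : ℝ) d]
    field_simp
  rw [h1]
  calc _ ≤ 1 / (M : ℝ) * ((M + N * (M + d - 1)) / (N + d)) := by gcongr
    _ = _ := by
      have h14 : (N + d : ℝ) ≠ 0 := by positivity
      field_simp
      ring

/-! ### Moments of the uniform distribution -/

lemma integral_pow_mul_conj_pow_mul_exp (n m : ℕ) :
    ∫ z : ℂ, z ^ n * star z ^ m * (Real.exp (-‖z‖ ^ 2) : ℂ) =
      if n = m then (Real.pi * n.factorial : ℂ) else 0 := by
  split_ifs with h
  · subst h
    have h1 := Complex.integral_rpow_mul_exp_neg_rpow (p := 2) (q := 2 * n) (by norm_num)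
      (by have : (0 : ℝ) ≤ n := by positivity
          linarith)
    have h2 : ∀ z : ℂ, z ^ n * star z ^ n * (Real.exp (-‖z‖ ^ 2) : ℂ) =
        ((‖z‖ ^ (2 * n : ℝ) * Real.exp (-‖z‖ ^ (2 : ℝ)) : ℝ) : ℂ) := by
      intro z
      have h3 : z * star z = ((‖z‖ ^ 2 : ℝ) : ℂ) := by
        rw [← starRingEnd_apply, Complex.mul_conj']; push_cast; rfl
      rw [← mul_pow, h3]
      have h4 : ‖z‖ ^ (2 * n : ℝ) = (‖z‖ ^ 2) ^ n := by
        rw [← pow_mul]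
        exact_mod_cast Real.rpow_natCast ‖z‖ (2 * n)
      rw [h4, Real.rpow_two]
      push_cast
      rfl
    simp_rw [h2]
    rw [integral_complex_ofReal, h1]
    have h5 : ((2 * (n : ℝ) + 2) / 2) = n + 1 := by ring
    rw [h5, Real.Gamma_nat_eq_factorial]
    push_cast
    ring
  -- Rotation by this angle multiplies the integrand by `exp (iπ) = -1` and preserves the measure,
  -- so the integral vanishes.
  · let θ : ℝ := Real.pi / ((n : ℝ) - m)
    let ω : Circle := Circle.exp θ
    have hω : (ω : ℂ) ^ n * star (ω : ℂ) ^ m = -1 := by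
      have h0 : ((n : ℂ) - m) ≠ 0 := by
        rw [sub_ne_zero]; exact_mod_cast h
      have h1 : (ω : ℂ) = Complex.exp (θ * Complex.I) := Circle.coe_exp θ
      rw [← starRingEnd_apply, h1, ← Complex.exp_conj, ← Complex.exp_nat_mul,
        ← Complex.exp_nat_mul, ← Complex.exp_add, ← Complex.exp_pi_mul_I]
      congr 1
      simp only [θ, map_mul, Complex.conj_ofReal, Complex.conj_I]
      push_cast
      field_simp
      ring
    have h1 := (rotation ω).measurePreserving.integral_comp
      (rotation ω).toHomeomorph.measurableEmbedding
      (fun z : ℂ => z ^ n * star z ^ m * (Real.exp (-‖z‖ ^ 2) : ℂ))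
    have h2 : ∀ z : ℂ, (rotation ω z) ^ n * star (rotation ω z) ^ m *
        (Real.exp (-‖rotation ω z‖ ^ 2) : ℂ) =
        -(z ^ n * star z ^ m * (Real.exp (-‖z‖ ^ 2) : ℂ)) := by
      intro z
      rw [LinearIsometryEquiv.norm_map, rotation_apply, star_mul', mul_pow, mul_pow]
      linear_combination (z ^ n * star z ^ m * (Real.exp (-‖z‖ ^ 2) : ℂ)) * hω
    simp_rw [h2] at h1
    rw [integral_neg] at h1
    exact self_eq_neg.mp h1.symm

/-- The permutations carrying `a` to `b` exist only if all letters have equal multiplicities. They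
then form a coset of the stabiliser of `a`, whose order is the product of the factorials of the
multiplicities. This is exactly the form taken by Gaussian moments. -/
lemma symm_apply_eq_prod {d n : ℕ} (a b : Fin n → Fin d) :
    symm d n a b = ∏ c, if Fintype.card {i // a i = c} = Fintype.card {i // b i = c} then
      ((Fintype.card {i // a i = c}).factorial : ℂ) else 0 := by
  by_cases h : ∀ c, Fintype.card {i // a i = c} = Fintype.card {i // b i = c}
  · have e : ∀ c, Nonempty ({i // b i = c} ≃ {i // a i = c}) := fun c =>
      Fintype.card_eq.mp (h c).symm
    let σ : Equiv.Perm (Fin n) := Equiv.ofFiberEquiv fun c => (e c).some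
    have hσ : a ∘ σ = b := by
      ext i
      exact congrArg _ (Equiv.ofFiberEquiv_map (fun c => (e c).some) i)
    rw [← hσ, symm_comp_right]
    have h1 := DomMulAct.stabilizer_card a
    rw [Fintype.card_subtype] at h1
    rw [hσ]
    simp only [h, if_true]
    simp only [← h]
    rw [← Nat.cast_prod, ← h1]
    simp [symm]
  · have h2 : symm d n a b = 0 := by
      refine Finset.sum_eq_zero fun σ _ => if_neg fun hσ => h fun c => ?_
      subst hσ
      exact Fintype.card_congr (σ.symm.subtypeEquiv fun i => by simp)
    push Not at h
    obtain ⟨c, hc⟩ := h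
    rw [h2]
    exact (Finset.prod_eq_zero (Finset.mem_univ c) (if_neg hc)).symm

/-- The homogeneous polynomial whose values on the sphere are the entries of `copies n ψ`. -/
def monomial {d n : ℕ} (a b : Fin n → Fin d) (x : Fin d → ℂ) : ℂ :=
  ∏ i, (x (a i) * star (x (b i)))

lemma monomial_eq_prod {d n : ℕ} (a b : Fin n → Fin d) (x : Fin d → ℂ) :
    monomial a b x = ∏ c, x c ^ Fintype.card {i // a i = c} *
      star (x c) ^ Fintype.card {i // b i = c} := by
  have h : ∀ (a : Fin n → Fin d) (f : Fin d → ℂ),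
      ∏ i, f (a i) = ∏ c, f c ^ Fintype.card {i // a i = c} := by
    intro a f
    rw [← Finset.prod_fiberwise' Finset.univ a f]
    simp [Fintype.card_subtype]
  rw [monomial, Finset.prod_mul_distrib, Finset.prod_mul_distrib, h a x,
    h b (fun c => star (x c))]

lemma integral_pi_monomial {d n : ℕ} (a b : Fin n → Fin d) :
    ∫ x : Fin d → ℂ, monomial a b x * (Real.exp (-∑ c, ‖x c‖ ^ 2) : ℂ) =
      (Real.pi : ℂ) ^ d * symm d n a b := by
  have h : ∀ x : Fin d → ℂ, monomial a b x * (Real.exp (-∑ c, ‖x c‖ ^ 2) : ℂ) =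
      ∏ c, (x c ^ Fintype.card {i // a i = c} * star (x c) ^ Fintype.card {i // b i = c} *
        (Real.exp (-‖x c‖ ^ 2) : ℂ)) := by
    intro x
    rw [monomial_eq_prod, Finset.prod_mul_distrib (g := fun c => (Real.exp (-‖x c‖ ^ 2) : ℂ)),
      ← Complex.ofReal_prod, ← Real.exp_sum, Finset.sum_neg_distrib]
  simp_rw [h]
  rw [volume_pi, integral_fintype_prod_eq_prod (μ := fun _ : Fin d => (volume : Measure ℂ))
    (f := fun c z => z ^ Fintype.card {i // a i = c} *
    star z ^ Fintype.card {i // b i = c} * (Real.exp (-‖z‖ ^ 2) : ℂ))]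
  simp_rw [integral_pow_mul_conj_pow_mul_exp]
  rw [symm_apply_eq_prod]
  have h2 : ((Real.pi : ℂ)) ^ d = ∏ _c : Fin d, (Real.pi : ℂ) := by simp
  rw [h2, ← Finset.prod_mul_distrib]
  refine Finset.prod_congr rfl fun c _ => ?_
  split_ifs <;> simp

/-- Uniqueness of Haar measure relates the Euclidean volume to the product volume up to a constant.
Its value is irrelevant, since the normalisation is recovered later from a trace. -/
lemma exists_integral_monomial (d : ℕ) :
    ∃ K : ℂ, ∀ (n : ℕ) (a b : Fin n → Fin d),
      K * ∫ x : EuclideanSpace ℂ (Fin d), monomial a b x * (Real.exp (-‖x‖ ^ 2) : ℂ) =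
        (Real.pi : ℂ) ^ d * symm d n a b := by
  let e : EuclideanSpace ℂ (Fin d) ≃L[ℝ] (Fin d → ℂ) :=
    PiLp.continuousLinearEquiv 2 ℝ (fun _ : Fin d => ℂ)
  let ν : Measure (EuclideanSpace ℂ (Fin d)) := (volume : Measure (Fin d → ℂ)).map e.symm
  have : ν.IsAddHaarMeasure := e.symm.isAddHaarMeasure_map _
  have hc := Measure.isAddLeftInvariant_eq_smul ν (volume : Measure (EuclideanSpace ℂ (Fin d)))
  refine ⟨((ν.addHaarScalarFactor (volume : Measure (EuclideanSpace ℂ (Fin d))) : ℝ) : ℂ),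
    fun n a b => ?_⟩
  rw [← integral_pi_monomial]
  have h1 : ∫ x, monomial a b x * (Real.exp (-‖x‖ ^ 2) : ℂ) ∂ν =
      ∫ x : Fin d → ℂ, monomial a b x * (Real.exp (-∑ c, ‖x c‖ ^ 2) : ℂ) := by
    refine (e.symm.toHomeomorph.measurableEmbedding.integral_map _).trans ?_
    refine integral_congr_ae (.of_forall fun x => ?_)
    simp only [EuclideanSpace.norm_sq_eq]
    rfl
  rw [← h1]
  conv_rhs => rw [hc]
  rw [integral_smul_nnreal_measure]
  simp [NNReal.smul_def]

/-- Polar coordinates: the polynomial is homogeneous of degree `2n`, so the integral splits into a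
spherical part and a radial factor `K` that does not depend on the words. -/
lemma integral_monomial_eq_mul (d : ℕ) (hd : 1 ≤ d) (n : ℕ) :
    ∃ K : ℂ, ∀ a b : Fin n → Fin d,
      ∫ x : EuclideanSpace ℂ (Fin d), monomial a b x * (Real.exp (-‖x‖ ^ 2) : ℂ) =
        K * ∫ ψ, copies n ψ a b ∂(volume : Measure (EuclideanSpace ℂ (Fin d))).toSphere := by
  have : Nonempty (Fin d) := ⟨⟨0, hd⟩⟩
  have : Nontrivial (EuclideanSpace ℂ (Fin d)) := inferInstance
  let μ : Measure (EuclideanSpace ℂ (Fin d)) := volume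
  refine ⟨∫ r : Set.Ioi (0 : ℝ), ((r : ℝ) ^ (2 * n) * Real.exp (-(r : ℝ) ^ 2) : ℝ)
    ∂(Measure.volumeIoiPow (Module.finrank ℝ (EuclideanSpace ℂ (Fin d)) - 1)), fun a b => ?_⟩
  let f : Metric.sphere (0 : EuclideanSpace ℂ (Fin d)) 1 × Set.Ioi (0 : ℝ) → ℂ := fun p =>
    copies n p.1 a b * (((p.2 : ℝ) ^ (2 * n) * Real.exp (-(p.2 : ℝ) ^ 2) : ℝ) : ℂ)
  calc ∫ x : EuclideanSpace ℂ (Fin d), monomial a b x * (Real.exp (-‖x‖ ^ 2) : ℂ)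
      = ∫ x : ({(0)}ᶜ : Set (EuclideanSpace ℂ (Fin d))),
          monomial a b x.1 * (Real.exp (-‖x.1‖ ^ 2) : ℂ) ∂(μ.comap (↑)) := by
        rw [integral_subtype_comap (measurableSet_singleton _).compl
          (fun x : EuclideanSpace ℂ (Fin d) => monomial a b x * (Real.exp (-‖x‖ ^ 2) : ℂ)),
          restrict_compl_singleton]
    _ = ∫ x : ({(0)}ᶜ : Set (EuclideanSpace ℂ (Fin d))),
          f (homeomorphUnitSphereProd (EuclideanSpace ℂ (Fin d)) x) ∂(μ.comap (↑)) := by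
        refine integral_congr_ae (.of_forall fun x => ?_)
        have hx : (‖x.1‖ : ℂ) ≠ 0 := by
          exact_mod_cast norm_ne_zero_iff.mpr x.2
        simp only [f, homeomorphUnitSphereProd_apply_snd_coe, copies,
          homeomorphUnitSphereProd_apply_fst_coe, monomial]
        push_cast
        rw [← mul_assoc]
        congr 1
        rw [pow_mul]
        have h1 : ((‖x.1‖ : ℂ) ^ 2) ^ n = ∏ _i : Fin n, (‖x.1‖ : ℂ) ^ 2 := by simp
        rw [h1, ← Finset.prod_mul_distrib]
        refine Finset.prod_congr rfl fun i _ => ?_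
        simp
        field_simp
    _ = ∫ p, f p ∂(μ.toSphere.prod (.volumeIoiPow
          (Module.finrank ℝ (EuclideanSpace ℂ (Fin d)) - 1))) :=
        μ.measurePreserving_homeomorphUnitSphereProd.integral_comp
          (Homeomorph.measurableEmbedding _) f
    _ = _ := by
        rw [integral_prod_mul (fun ψ => copies n ψ a b)
          (fun r : Set.Ioi (0 : ℝ) => (((r : ℝ) ^ (2 * n) * Real.exp (-(r : ℝ) ^ 2) : ℝ) : ℂ)),
          mul_comm, integral_complex_ofReal]

lemma isProbabilityMeasure_uniform {d : ℕ} (hd : 1 ≤ d) : IsProbabilityMeasure (uniform d) := by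
  have : Nonempty (Fin d) := ⟨⟨0, hd⟩⟩
  constructor
  rw [uniform, Measure.smul_apply, smul_eq_mul, ENNReal.inv_mul_cancel]
  · rw [Measure.toSphere_apply_univ]
    have h1 : (Module.finrank ℝ (EuclideanSpace ℂ (Fin d))) ≠ 0 := Module.finrank_pos.ne'
    have h2 := (Metric.measure_ball_pos (volume : Measure (EuclideanSpace ℂ (Fin d))) 0
      one_pos).ne'
    simp [h1, h2]
  · exact measure_ne_top _ _

/-- The moments of the uniform distribution: the average of `(|ψ⟩⟨ψ|)^{⊗n}` is the normalised
projection onto the symmetric subspace. -/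
lemma integral_copies_uniform {d : ℕ} (hd : 1 ≤ d) (n : ℕ) (a b : Fin n → Fin d) :
    ∫ ψ, copies n ψ a b ∂(uniform d) = symm d n a b / symmTrace d n := by
  have hprob := isProbabilityMeasure_uniform hd
  obtain ⟨K₁, hK₁⟩ := exists_integral_monomial d
  obtain ⟨K₂, hK₂⟩ := integral_monomial_eq_mul d hd n
  have h1 : ∀ a b : Fin n → Fin d, ∫ ψ, copies n ψ a b ∂(uniform d) =
      (((volume : Measure (EuclideanSpace ℂ (Fin d))).toSphere Set.univ)⁻¹.toReal : ℂ) *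
      ∫ ψ, copies n ψ a b ∂(volume : Measure (EuclideanSpace ℂ (Fin d))).toSphere := by
    intro a b
    rw [uniform, integral_smul_measure]
    simp
  set s : ℂ := (((volume : Measure (EuclideanSpace ℂ (Fin d))).toSphere Set.univ)⁻¹.toReal : ℂ)
  have hs : s ≠ 0 := by
    intro h0
    have h3 : ∑ a, ∫ ψ, copies n ψ a a ∂(uniform d) = 1 := by
      rw [← integral_finsetSum _ fun a _ =>
        integrable_of_continuous ((continuous_copies n).matrix_elem a a)]
      have : ∀ ψ : PureState d, ∑ a, copies n ψ a a = 1 := fun ψ => trace_copies n ψ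
      simp [this]
    simp [h1, h0] at h3
  have h4 : ∀ a b : Fin n → Fin d, K₁ * K₂ * ∫ ψ, copies n ψ a b ∂(uniform d) =
      s * (Real.pi : ℂ) ^ d * symm d n a b := by
    intro a b
    rw [h1, mul_assoc s, ← hK₁, hK₂]
    ring
  -- Taking the trace of `h4` determines the unknown constants, because the average of `ψ^{⊗n}` has
  -- trace one.
  have h5 : K₁ * K₂ = s * (Real.pi : ℂ) ^ d * symmTrace d n := by
    have h6 : ∑ a, ∫ ψ, copies n ψ a a ∂(uniform d) = 1 := by
      rw [← integral_finsetSum _ fun a _ =>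
        integrable_of_continuous ((continuous_copies n).matrix_elem a a)]
      have : ∀ ψ : PureState d, ∑ a, copies n ψ a a = 1 := fun ψ => trace_copies n ψ
      simp [this]
    have h7 : ∑ a, symm d n a a = symmTrace d n := trace_symm d n
    rw [← mul_one (K₁ * K₂), ← h6, Finset.mul_sum]
    simp_rw [h4]
    rw [← Finset.mul_sum, h7]
  have hτ : (symmTrace d n : ℂ) ≠ 0 := by exact_mod_cast (symmTrace_pos hd n).ne'
  have hπ : (Real.pi : ℂ) ^ d ≠ 0 := pow_ne_zero _ (by exact_mod_cast Real.pi_ne_zero)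
  have h8 := h4 a b
  rw [h5, mul_assoc] at h8
  rw [mul_assoc s, mul_assoc s] at h8
  have h9 := mul_left_cancel₀ hs h8
  rw [eq_div_iff hτ, mul_comm]
  exact mul_left_cancel₀ hπ h9

/-! ### Traces of products of positive operators -/

lemma re_trace_mul_nonneg {n : Type*} [Fintype n] {A B : Matrix n n ℂ} (hA : A.PosSemidef)
    (hB : B.PosSemidef) : 0 ≤ (A * B).trace.re := by
  obtain ⟨s, v, rfl⟩ := Matrix.posSemidef_iff_eq_sum_vecMulVec.mp hB
  rw [Finset.mul_sum, Matrix.trace_sum, Complex.re_sum]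
  refine Finset.sum_nonneg fun i _ => ?_
  rw [Matrix.mul_vecMulVec, Matrix.trace_vecMulVec, dotProduct_comm]
  exact (Complex.nonneg_iff.mp (hA.dotProduct_mulVec_nonneg (v i))).1

lemma copies_eq_vecMulVec {d : ℕ} (n : ℕ) (ψ : PureState d) :
    copies n ψ = Matrix.vecMulVec (fun a => ∏ i, ψ.1 (a i)) (star fun a => ∏ i, ψ.1 (a i)) := by
  ext a b
  simp [copies, Matrix.vecMulVec_apply, Finset.prod_mul_distrib]

lemma posSemidef_copies {d : ℕ} (n : ℕ) (ψ : PureState d) : (copies n ψ).PosSemidef := by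
  rw [copies_eq_vecMulVec]
  exact Matrix.posSemidef_vecMulVec_self_star _

lemma fidelity_vecMulVec {d : ℕ} (ψ : PureState d) (b : Fin d → ℂ) :
    fidelity ψ (Matrix.vecMulVec b (star b)) = ‖∑ a, star (b a) * ψ.1 a‖ ^ 2 := by
  have h : ∑ a, ∑ c, star (ψ.1 a) * Matrix.vecMulVec b (star b) a c * ψ.1 c =
      ((‖∑ a, star (b a) * ψ.1 a‖ ^ 2 : ℝ) : ℂ) := by
    push_cast
    rw [← Complex.mul_conj', starRingEnd_apply, star_sum, mul_comm, Finset.sum_mul_sum]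
    refine Finset.sum_congr rfl fun a _ => Finset.sum_congr rfl fun c _ => ?_
    simp only [Matrix.vecMulVec_apply, Pi.star_apply, star_mul', star_star]
    ring
  rw [fidelity, h, Complex.ofReal_re]

lemma inner_eq_sum {d : ℕ} (φ ψ : PureState d) :
    inner ℂ φ.1 ψ.1 = ∑ a, star (φ.1 a) * ψ.1 a := by
  rw [PiLp.inner_apply]
  refine Finset.sum_congr rfl fun a _ => ?_
  rw [RCLike.inner_apply, mul_comm]
  rfl

lemma norm_inner_sq_le_one {d : ℕ} (φ ψ : PureState d) : ‖inner ℂ φ.1 ψ.1‖ ^ 2 ≤ 1 := by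
  have h := norm_inner_le_norm (𝕜 := ℂ) φ.1 ψ.1
  have h1 : ‖φ.1‖ = 1 := by simp
  have h2 : ‖ψ.1‖ = 1 := by simp
  rw [h1, h2, one_mul] at h
  exact pow_le_one₀ (norm_nonneg _) h

lemma fidelity_add {d : ℕ} (ψ : PureState d) (A B : Matrix (Fin d) (Fin d) ℂ) :
    fidelity ψ (A + B) = fidelity ψ A + fidelity ψ B := by
  simp [fidelity_eq_trace, Matrix.add_mul]

lemma fidelity_smul {d : ℕ} (ψ : PureState d) (c : ℝ) (A : Matrix (Fin d) (Fin d) ℂ) :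
    fidelity ψ ((c : ℂ) • A) = c * fidelity ψ A := by
  simp [fidelity_eq_trace]

lemma fidelity_sum {d : ℕ} {ι : Type*} (s : Finset ι) (ψ : PureState d)
    (A : ι → Matrix (Fin d) (Fin d) ℂ) :
    fidelity ψ (∑ i ∈ s, A i) = ∑ i ∈ s, fidelity ψ (A i) := by
  simp [fidelity_eq_trace, Finset.sum_mul, Matrix.trace_sum]

lemma fidelity_one {d : ℕ} (ψ : PureState d) : fidelity ψ 1 = 1 := by
  rw [fidelity_eq_trace, one_mul, trace_proj, Complex.one_re]

lemma continuous_fidelity {d : ℕ} (A : Matrix (Fin d) (Fin d) ℂ) :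
    Continuous fun ψ : PureState d => fidelity ψ A := by
  unfold fidelity
  fun_prop

lemma continuous_outcome {d N : ℕ} (A : Op d N) :
    Continuous fun ψ : PureState d => (A * copies N ψ).trace.re :=
  Complex.continuous_re.comp
    (continuous_const.matrix_mul (continuous_copies N)).matrix_trace

/-! ### Estimation strategies -/

lemma Estimator.avgFidelity_le_one {d N : ℕ} (ν : Measure (PureState d)) [IsProbabilityMeasure ν]
    (E : Estimator d N) : E.avgFidelity ν ≤ 1 := by
  unfold Estimator.avgFidelity
  have h1 : ∀ j, ∫ ψ, ((E.effect j * copies N ψ).trace).re * ‖inner ℂ (E.guess j).1 ψ.1‖ ^ 2 ∂ν ≤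
      ∫ ψ, ((E.effect j * copies N ψ).trace).re ∂ν := by
    intro j
    refine integral_mono (integrable_of_continuous ?_)
      (integrable_of_continuous (continuous_outcome _)) fun ψ => ?_
    · exact (continuous_outcome _).mul (by fun_prop)
    · exact mul_le_of_le_one_right (re_trace_mul_nonneg (E.posSemidef j) (posSemidef_copies N ψ))
        (norm_inner_sq_le_one _ _)
  refine (Finset.sum_le_sum fun j _ => h1 j).trans (le_of_eq ?_)
  rw [← integral_finsetSum _ fun j _ => integrable_of_continuous (continuous_outcome _)]
  have h2 : ∀ ψ : PureState d, ∑ j, ((E.effect j * copies N ψ).trace).re = 1 := by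
    intro ψ
    rw [← Complex.re_sum, ← Matrix.trace_sum, ← Finset.sum_mul, E.sum_effect, one_mul,
      trace_copies, Complex.one_re]
  simp [h2]

lemma bddAbove_estimation {d : ℕ} (ν : Measure (PureState d)) [IsProbabilityMeasure ν] (N : ℕ) :
    BddAbove (Set.range fun E : Estimator d N => E.avgFidelity ν) :=
  ⟨1, by rintro _ ⟨E, rfl⟩; exact E.avgFidelity_le_one ν⟩

lemma nonempty_pureState {d : ℕ} (hd : 1 ≤ d) : Nonempty (PureState d) :=
  ⟨⟨EuclideanSpace.single ⟨0, hd⟩ 1, by simp⟩⟩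

/-- The trivial measurement. -/
lemma nonempty_estimator {d : ℕ} (hd : 1 ≤ d) (N : ℕ) : Nonempty (Estimator d N) :=
  ⟨{ outcomes := 1
     effect := fun _ => 1
     posSemidef := fun _ => Matrix.PosSemidef.one
     sum_effect := by simp
     guess := fun _ => (nonempty_pureState hd).some }⟩

/-- Measurements may have any finite set of outcomes. -/
lemma le_optEstimation {d N : ℕ} {ι : Type*} [Fintype ι] (ν : Measure (PureState d))
    [IsProbabilityMeasure ν] (F : ι → Op d N) (hF : ∀ i, (F i).PosSemidef) (hF1 : ∑ i, F i = 1)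
    (φ : ι → PureState d) :
    ∑ i, ∫ ψ, ((F i * copies N ψ).trace).re * ‖inner ℂ (φ i).1 ψ.1‖ ^ 2 ∂ν ≤
      optEstimation ν N := by
  let e := (Fintype.equivFin ι).symm
  let E : Estimator d N :=
    { outcomes := Fintype.card ι
      effect := fun j => F (e j)
      posSemidef := fun j => hF _
      sum_effect := (Equiv.sum_comp e F).trans hF1
      guess := fun j => φ (e j) }
  have h := le_csSup (bddAbove_estimation ν N) ⟨E, rfl⟩
  refine le_trans (le_of_eq ?_) h
  exact (Equiv.sum_comp e (fun i => ∫ ψ, ((F i * copies N ψ).trace).re *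
    ‖inner ℂ (φ i).1 ψ.1‖ ^ 2 ∂ν)).symm

lemma exists_pureState_smul {d : ℕ} (hd : 1 ≤ d) (b : Fin d → ℂ) :
    ∃ φ : PureState d, ∀ a, b a = (Real.sqrt (∑ c, ‖b c‖ ^ 2) : ℂ) * φ.1 a := by
  set x : EuclideanSpace ℂ (Fin d) := WithLp.toLp 2 b with hx
  have hn : Real.sqrt (∑ c, ‖b c‖ ^ 2) = ‖x‖ := by rw [EuclideanSpace.norm_eq]
  rw [hn]
  by_cases h : x = 0
  · refine ⟨(nonempty_pureState hd).some, fun a => ?_⟩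
    have : b a = x a := rfl
    rw [this, h]
    simp
  · have hx0 : ‖x‖ ≠ 0 := norm_ne_zero_iff.mpr h
    refine ⟨⟨(‖x‖⁻¹ : ℂ) • x, ?_⟩, fun a => ?_⟩
    · simp [norm_smul, hx0]
    · have : (‖x‖ : ℂ) ≠ 0 := by exact_mod_cast hx0
      change b a = (‖x‖ : ℂ) * ((‖x‖ : ℂ)⁻¹ * b a)
      field_simp

/-- Guessing mixed states does not help. -/
lemma le_optEstimation_of_mixed {d N : ℕ} (hd : 1 ≤ d) {ι : Type*} [Fintype ι]
    (ν : Measure (PureState d))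
    [IsProbabilityMeasure ν] (F : ι → Op d N) (hF : ∀ i, (F i).PosSemidef) (hF1 : ∑ i, F i = 1)
    (τ : ι → Matrix (Fin d) (Fin d) ℂ) (hτ : ∀ i, (τ i).PosSemidef) (hτ1 : ∀ i, (τ i).trace = 1) :
    ∫ ψ, ∑ i, ((F i * copies N ψ).trace).re * fidelity ψ (τ i) ∂ν ≤ optEstimation ν N := by
  choose s v hv using fun i => Matrix.posSemidef_iff_eq_sum_vecMulVec.mp (hτ i)
  choose φ hφ using fun (p : Σ i, Fin (s i)) => exists_pureState_smul hd (v p.1 p.2)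
  set q : (Σ i, Fin (s i)) → ℝ := fun p => ∑ c, ‖v p.1 p.2 c‖ ^ 2 with hq
  have hq0 : ∀ p, 0 ≤ q p := fun p => by positivity
  have hq1 : ∀ i, ∑ r, q ⟨i, r⟩ = 1 := by
    intro i
    have h1 := hτ1 i
    rw [hv, Matrix.trace_sum] at h1
    have h2 : ∀ r, (Matrix.vecMulVec (v i r) (star (v i r))).trace = ((q ⟨i, r⟩ : ℝ) : ℂ) := by
      intro r
      simp only [hq, Matrix.trace, Matrix.diag_apply, Matrix.vecMulVec_apply, Pi.star_apply]
      push_cast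
      exact Finset.sum_congr rfl fun c _ => Complex.mul_conj' _
    simp_rw [h2] at h1
    exact_mod_cast h1
  -- Outcome `i` is refined to outcomes `(i, r)`, with `r` drawn according to the weights `q` of a
  -- decomposition of `τ i` into pure states.
  have h := le_optEstimation ν (fun p : Σ i, Fin (s i) => (q p : ℂ) • F p.1)
    (fun p => (hF _).smul (Complex.zero_le_real.mpr (hq0 p)))
    (by
      rw [Fintype.sum_sigma, ← hF1]
      refine Finset.sum_congr rfl fun i _ => ?_
      change ∑ r, (q ⟨i, r⟩ : ℂ) • F i = F i
      rw [← Finset.sum_smul, ← Complex.ofReal_sum, hq1, Complex.ofReal_one, one_smul]) φ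
  refine le_trans (le_of_eq ?_) h
  rw [← integral_finsetSum]
  · congr 1
    ext ψ
    rw [Fintype.sum_sigma]
    refine Finset.sum_congr rfl fun i _ => ?_
    conv_lhs => rw [hv i]
    rw [fidelity_sum, Finset.mul_sum]
    refine Finset.sum_congr rfl fun r _ => ?_
    rw [fidelity_vecMulVec, inner_eq_sum, Matrix.smul_mul, Matrix.trace_smul, smul_eq_mul,
      Complex.re_ofReal_mul]
    have h3 : ∑ a, star (v i r a) * ψ.1 a =
        (Real.sqrt (q ⟨i, r⟩) : ℂ) * ∑ a, star ((φ ⟨i, r⟩).1 a) * ψ.1 a := by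
      rw [Finset.mul_sum]
      refine Finset.sum_congr rfl fun a _ => ?_
      have := hφ ⟨i, r⟩ a
      simp only at this
      rw [this, star_mul', ← starRingEnd_apply, Complex.conj_ofReal]
      ring
    rw [h3, norm_mul, mul_pow, Complex.norm_real, Real.norm_eq_abs, sq_abs,
      Real.sq_sqrt (hq0 _)]
    ring
  · intro p _
    refine integrable_of_continuous ?_
    exact (continuous_outcome _).mul (by fun_prop)

/-! ### Measuring and preparing -/

lemma site_mul_site {d n : ℕ} (k : Fin n) (A B : Matrix (Fin d) (Fin d) ℂ) :
    (site k A * site k B : Op d n) = site k (A * B) := by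
  ext x y
  rw [site_mul_apply]
  simp only [site, Function.update_idem, Function.update_self, Matrix.mul_apply]
  split_ifs <;> simp

lemma site_smul {d n : ℕ} (k : Fin n) (c : ℂ) (A : Matrix (Fin d) (Fin d) ℂ) :
    (site k (c • A) : Op d n) = c • site k A := by
  ext x y
  simp [site]

lemma conjTranspose_site {d n : ℕ} (k : Fin n) (A : Matrix (Fin d) (Fin d) ℂ) :
    (site k A : Op d n).conjTranspose = site k A.conjTranspose := by
  ext x y
  simp only [Matrix.conjTranspose_apply, site]
  simp_rw [eq_update_comm k y x]
  split_ifs <;> simp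

lemma conjTranspose_proj {d : ℕ} (ψ : PureState d) : (proj ψ).conjTranspose = proj ψ := by
  ext a b
  simp [proj, mul_comm]

lemma site_mul_copies {d n : ℕ} (ψ : PureState d) (k : Fin n) :
    site k (proj ψ) * copies n ψ = copies n ψ := by
  have h := congrArg Matrix.conjTranspose (copies_mul_site ψ k)
  rwa [Matrix.conjTranspose_mul, conjTranspose_site, conjTranspose_proj,
    (posSemidef_copies n ψ).isHermitian.eq] at h

lemma proj_mul_proj_mul_proj {d : ℕ} (φ ψ : PureState d) :
    proj φ * proj ψ * proj φ = ((‖inner ℂ φ.1 ψ.1‖ ^ 2 : ℝ) : ℂ) • proj φ := by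
  ext a b
  push_cast
  rw [← Complex.mul_conj', inner_eq_sum, starRingEnd_apply, star_sum, Finset.sum_mul_sum]
  simp only [Matrix.mul_apply, proj, Matrix.smul_apply, smul_eq_mul, Finset.sum_mul, star_mul',
    star_star]
  rw [Finset.sum_comm]
  refine Finset.sum_congr rfl fun c _ => Finset.sum_congr rfl fun e _ => ?_
  ring

lemma trace_copies_mul_site {d n : ℕ} (φ ψ : PureState d) (k : Fin n) :
    (copies n φ * site k (proj ψ)).trace = ((‖inner ℂ φ.1 ψ.1‖ ^ 2 : ℝ) : ℂ) := by
  calc (copies n φ * site k (proj ψ)).trace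
      = (site k (proj φ) * (copies n φ * site k (proj φ)) * site k (proj ψ)).trace := by
        rw [copies_mul_site, site_mul_copies]
    _ = (copies n φ * (site k (proj φ) * site k (proj ψ) * site k (proj φ))).trace := by
        rw [Matrix.mul_assoc, Matrix.trace_mul_comm]
        simp only [Matrix.mul_assoc]
    _ = _ := by
        rw [site_mul_site, site_mul_site, proj_mul_proj_mul_proj, site_smul, Matrix.mul_smul,
          copies_mul_site, Matrix.trace_smul, trace_copies, smul_eq_mul, mul_one]

/-- The cloner that measures the input and prepares copies of the guessed state. -/
def Estimator.toCloner {d N : ℕ} (E : Estimator d N) (M : ℕ) : Cloner d N M where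
  toMap := ∑ j, prepareMap (E.effect j) (copies M (E.guess j))
  completelyPositive := .sum _ fun j =>
    isCompletelyPositive_prepareMap (E.posSemidef j) (posSemidef_copies M _)
  trace_map X := by
    simp only [LinearMap.sum_apply, prepareMap_apply, Matrix.trace_sum, Matrix.trace_smul,
      trace_copies, smul_eq_mul, mul_one]
    rw [← Matrix.trace_sum, ← Finset.sum_mul, E.sum_effect, one_mul]

/-- Every clone has the fidelity of the guess, so averaging over clones changes nothing. For `M = 0`
the sum over clones is empty, whence `1 ≤ M`. -/
lemma Estimator.avgFidelity_toCloner {d N M : ℕ} (hM : 1 ≤ M) (ν : Measure (PureState d))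
    [IsFiniteMeasure ν] (E : Estimator d N) :
    (E.toCloner M).avgFidelity ν = E.avgFidelity ν := by
  have h1 : ∀ k ψ, (E.toCloner M).cloneFidelity k ψ =
      ∑ j, ((E.effect j * copies N ψ).trace).re * ‖inner ℂ (E.guess j).1 ψ.1‖ ^ 2 := by
    intro k ψ
    simp only [Cloner.cloneFidelity, Estimator.toCloner, fidelity_reduced, LinearMap.sum_apply,
      prepareMap_apply, Finset.sum_mul, Matrix.trace_sum, Complex.re_sum, Matrix.smul_mul,
      Matrix.trace_smul, trace_copies_mul_site, smul_eq_mul, Complex.re_mul_ofReal]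
  have hM0 : (M : ℝ) ≠ 0 := by exact_mod_cast (by omega : M ≠ 0)
  unfold Cloner.avgFidelity
  simp_rw [h1, integral_const_mul]
  rw [Finset.sum_const, Finset.card_univ, Fintype.card_fin, nsmul_eq_mul, ← mul_assoc,
    mul_one_div_cancel hM0, one_mul, integral_finsetSum]
  · rfl
  · intro j _
    refine integrable_of_continuous ?_
    exact (continuous_outcome _).mul (by fun_prop)

/-! ### Product operators -/

/-- The product operator `G₁ ⊗ ⋯ ⊗ G_M`. -/
def tensor {d M : ℕ} (G : Fin M → Matrix (Fin d) (Fin d) ℂ) : Op d M :=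
  fun a b => ∏ k, G k (a k) (b k)

lemma tensor_sum {d M : ℕ} {κ : Fin M → Type*} [∀ k, Fintype (κ k)]
    (G : ∀ k, κ k → Matrix (Fin d) (Fin d) ℂ) :
    tensor (fun k => ∑ x, G k x) = ∑ w : ∀ k, κ k, tensor fun k => G k (w k) := by
  ext a b
  simp only [tensor, Matrix.sum_apply]
  rw [Finset.prod_univ_sum, Fintype.piFinset_univ]

lemma tensor_smul {d M : ℕ} (c : Fin M → ℂ) (G : Fin M → Matrix (Fin d) (Fin d) ℂ) :
    tensor (fun k => c k • G k) = (∏ k, c k) • tensor G := by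
  ext a b
  simp [tensor, Finset.prod_mul_distrib]

lemma tensor_one {d M : ℕ} : tensor (fun _ : Fin M => (1 : Matrix (Fin d) (Fin d) ℂ)) = 1 := by
  ext a b
  simp only [tensor, Matrix.one_apply, Fintype.prod_boole, funext_iff]
  congr 1

lemma tensor_site {d M : ℕ} (k : Fin M) (B : Matrix (Fin d) (Fin d) ℂ) :
    tensor (fun j => if j = k then B else 1) = site k B := by
  ext a b
  simp only [tensor, site]
  rw [← Finset.mul_prod_erase _ _ (Finset.mem_univ k), if_pos rfl]
  have h : ∏ j ∈ Finset.univ.erase k, (if j = k then B else 1) (a j) (b j) =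
      if b = Function.update a k (b k) then 1 else 0 := by
    have h1 : ∀ j ∈ Finset.univ.erase k, (if j = k then B else 1) (a j) (b j) =
        if b j = a j then (1 : ℂ) else 0 := by
      intro j hj
      rw [if_neg (Finset.ne_of_mem_erase hj), Matrix.one_apply]
      simp_rw [eq_comm]
    rw [Finset.prod_congr rfl h1, Finset.prod_boole]
    congr 1
    simp only [Finset.mem_erase, Finset.mem_univ, and_true, eq_iff_iff]
    rw [Function.eq_update_iff]
    simp
  rw [h]
  simp

lemma posSemidef_tensor {d M : ℕ} {G : Fin M → Matrix (Fin d) (Fin d) ℂ}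
    (hG : ∀ k, (G k).PosSemidef) : (tensor G).PosSemidef := by
  choose s v hv using fun k => Matrix.posSemidef_iff_eq_sum_vecMulVec.mp (hG k)
  have h : tensor G = ∑ w : ∀ k, Fin (s k),
      Matrix.vecMulVec (fun a => ∏ k, v k (w k) (a k)) (star fun a => ∏ k, v k (w k) (a k)) := by
    rw [funext hv, tensor_sum]
    refine Finset.sum_congr rfl fun w _ => ?_
    ext a b
    simp [tensor, Matrix.vecMulVec_apply, Finset.prod_mul_distrib]
  rw [h]
  exact Matrix.posSemidef_sum _ fun w _ => Matrix.posSemidef_vecMulVec_self_star _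

/-- If `0 ≤ G ≤ g` then `G^{⊗M} ≤ g^M`. -/
lemma posSemidef_pow_sub_tensor {d M : ℕ} {G : Matrix (Fin d) (Fin d) ℂ} {g : ℝ}
    (hG : G.PosSemidef) (hg : ((g : ℂ) • 1 - G).PosSemidef) :
    (((g ^ M : ℝ) : ℂ) • 1 - tensor fun _ : Fin M => G : Op d M).PosSemidef := by
  -- Writing `g = G + (g - G)` in every factor expands `g ^ M` into products of positive operators,
  -- one of which is `G^{⊗M}`.
  let H : Bool → Matrix (Fin d) (Fin d) ℂ := fun s => if s then G else (g : ℂ) • 1 - G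
  have hH : ∀ s, (H s).PosSemidef := by rintro (_ | _) <;> simpa [H]
  have h1 : (((g ^ M : ℝ) : ℂ) • 1 : Op d M) =
      ∑ w : Fin M → Bool, tensor fun k => H (w k) := by
    rw [← tensor_sum (fun _ s => H s)]
    have : ∑ s, H s = (g : ℂ) • 1 := by simp [H]
    simp only [this]
    rw [tensor_smul, tensor_one]
    simp
  have h2 : (tensor fun _ : Fin M => G) = tensor fun k => H ((fun _ => true) k) := by simp [H]
  rw [h1, h2, ← Finset.sum_erase_add _ _ (Finset.mem_univ (fun _ : Fin M => true)),
    add_sub_cancel_right]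
  exact Matrix.posSemidef_sum _ fun w _ => posSemidef_tensor fun k => hH _

/-! ### Local tomography -/

/-- A measurement on `ℂ^d` with a hermitian, trace-one estimate of the state for each outcome
that is correct on average. -/
structure Tomography (d : ℕ) (Ω : Type) [Fintype Ω] where
  effect : Ω → Matrix (Fin d) (Fin d) ℂ
  posSemidef : ∀ x, (effect x).PosSemidef
  sum_effect : ∑ x, effect x = 1
  estimate : Ω → Matrix (Fin d) (Fin d) ℂ
  isHermitian : ∀ x, (estimate x).IsHermitian
  trace_estimate : ∀ x, (estimate x).trace = 1
  -- Equivalently `∑ₓ tr (effectₓ ρ) • estimateₓ = ρ` for every `ρ`, and dually `∑ₓ tr (A estimateₓ)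
  -- • effectₓ = A` for every `A`.
  unbiased : ∀ p q r s, ∑ x, estimate x p q * effect x r s = if p = s ∧ q = r then 1 else 0

/-- The vector `e_a + i^j e_b`. -/
def tomographyVec {d : ℕ} (x : Fin d × Fin d × Fin 4) (p : Fin d) : ℂ :=
  (if p = x.1 then 1 else 0) + Complex.I ^ (x.2.2 : ℕ) * (if p = x.2.1 then 1 else 0)

lemma sum_tomographyVec {d : ℕ} (a b r s : Fin d) :
    ∑ j, tomographyVec (a, b, j) r * star (tomographyVec (a, b, j) s) =
      4 * ((if r = a ∧ s = a then 1 else 0) + if r = b ∧ s = b then 1 else 0) := by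
  simp only [tomographyVec, Fin.sum_univ_four]
  simp [pow_succ, ite_and]
  split_ifs <;> ring_nf <;> simp <;> ring

/-- Orthogonality of the characters of `ℤ/4`: weighting by `i^j` keeps only the cross term in which
the phase cancels, so a single matrix unit survives. -/
lemma sum_phase_tomographyVec {d : ℕ} (a b r s : Fin d) :
    ∑ j : Fin 4, Complex.I ^ (j : ℕ) *
      (tomographyVec (a, b, j) r * star (tomographyVec (a, b, j) s)) =
      4 * (if r = a ∧ s = b then 1 else 0) := by
  simp only [tomographyVec, Fin.sum_univ_four]
  simp [pow_succ, ite_and]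
  split_ifs <;> ring_nf <;> simp <;> ring

lemma sum_conj_phase_tomographyVec {d : ℕ} (a b r s : Fin d) :
    ∑ j : Fin 4, star (Complex.I ^ (j : ℕ)) *
      (tomographyVec (a, b, j) r * star (tomographyVec (a, b, j) s)) =
      4 * (if r = b ∧ s = a then 1 else 0) := by
  simp only [tomographyVec, Fin.sum_univ_four]
  simp [pow_succ, ite_and]
  split_ifs <;> ring_nf <;> simp <;> ring

/-- The effects `u u† / 8d` of the tomographic measurement, where `u = e_a + i^j e_b`. -/
def tomographyEffect (d : ℕ) (x : Fin d × Fin d × Fin 4) : Matrix (Fin d) (Fin d) ℂ :=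
  (((8 * d : ℝ)⁻¹ : ℝ) : ℂ) • Matrix.vecMulVec (tomographyVec x) (star (tomographyVec x))

lemma tomographyEffect_apply {d : ℕ} (x : Fin d × Fin d × Fin 4) (r s : Fin d) :
    tomographyEffect d x r s =
      (8 * d : ℂ)⁻¹ * (tomographyVec x r * star (tomographyVec x s)) := by
  simp [tomographyEffect, Matrix.vecMulVec_apply]

/-- The dual frame of the tomographic effects, before normalising the trace. -/
def tomographyDual (d : ℕ) (x : Fin d × Fin d × Fin 4) : Matrix (Fin d) (Fin d) ℂ :=
  fun p q => d * (Complex.I ^ (x.2.2 : ℕ) * (if x.1 = q ∧ x.2.1 = p then 1 else 0) +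
    star (Complex.I ^ (x.2.2 : ℕ)) * (if x.1 = p ∧ x.2.1 = q then 1 else 0))

lemma sum_tomographyEffect {d : ℕ} (hd : 1 ≤ d) : ∑ x, tomographyEffect d x = 1 := by
  have hd0 : (d : ℂ) ≠ 0 := by exact_mod_cast (by omega : d ≠ 0)
  ext r s
  rw [Matrix.sum_apply]
  simp only [tomographyEffect_apply, ← Finset.mul_sum]
  rw [Fintype.sum_prod_type]
  simp only [Fintype.sum_prod_type, sum_tomographyVec, ← Finset.mul_sum, Finset.sum_add_distrib]
  simp only [ite_and, Finset.sum_ite_eq, Finset.mem_univ, if_true, Finset.sum_const,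
    Finset.card_univ, Fintype.card_fin, nsmul_eq_mul, Matrix.one_apply]
  by_cases h : r = s
  · subst h
    simp
    field_simp
    norm_num
  · have h1 : ∀ c : Fin d, ¬(r = c ∧ s = c) := fun c hc => h (hc.1.trans hc.2.symm)
    have h2 : ∀ c : Fin d, (if r = c then if s = c then (1 : ℂ) else 0 else 0) = 0 := by
      intro c
      rw [← ite_and, if_neg (h1 c)]
    simp [h2, h, Ne.symm h]

lemma sum_tomographyDual_mul {d : ℕ} (hd : 1 ≤ d) (p q r s : Fin d) :
    ∑ x, tomographyDual d x p q * tomographyEffect d x r s =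
      if p = s ∧ q = r then 1 else 0 := by
  have hd0 : (d : ℂ) ≠ 0 := by exact_mod_cast (by omega : d ≠ 0)
  have h1 : ∀ a b : Fin d, ∑ j, tomographyDual d (a, b, j) p q * tomographyEffect d (a, b, j) r s =
      (if a = q ∧ b = p then (if r = a ∧ s = b then 1 / 2 else 0) else 0) +
      (if a = p ∧ b = q then (if r = b ∧ s = a then 1 / 2 else 0) else 0) := by
    intro a b
    have h2 : ∀ j, tomographyDual d (a, b, j) p q * tomographyEffect d (a, b, j) r s =
        (if a = q ∧ b = p then 1 else 0) / 8 * (Complex.I ^ (j : ℕ) *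
          (tomographyVec (a, b, j) r * star (tomographyVec (a, b, j) s))) +
        (if a = p ∧ b = q then 1 else 0) / 8 * (star (Complex.I ^ (j : ℕ)) *
          (tomographyVec (a, b, j) r * star (tomographyVec (a, b, j) s))) := by
      intro j
      rw [tomographyEffect_apply, tomographyDual]
      field_simp
    simp_rw [h2]
    rw [Finset.sum_add_distrib, ← Finset.mul_sum, ← Finset.mul_sum, sum_phase_tomographyVec,
      sum_conj_phase_tomographyVec]
    congr 1 <;> split_ifs <;> norm_num
  rw [Fintype.sum_prod_type]
  simp only [Fintype.sum_prod_type, h1, Finset.sum_add_distrib]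
  simp only [ite_and, Finset.sum_ite_irrel, Finset.sum_const_zero, Finset.sum_ite_eq',
    Finset.mem_univ, if_true]
  by_cases h3 : p = s <;> by_cases h4 : q = r <;> simp [h3, h4, eq_comm]
  norm_num

/-- The dual frame is Hermitian and reproduces operators. A multiple of the identity is added to
each estimate to make its trace one. -/
lemma exists_tomography {d : ℕ} (hd : 1 ≤ d) :
    Nonempty (Tomography d (Fin d × Fin d × Fin 4)) := by
  have hd0 : (d : ℂ) ≠ 0 := by exact_mod_cast (by omega : d ≠ 0)
  have hH : ∀ x, (tomographyDual d x).IsHermitian := by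
    intro x
    ext p q
    rw [Matrix.conjTranspose_apply]
    simp only [tomographyDual]
    rw [star_mul', star_add, star_mul', star_mul', star_star, star_natCast]
    rw [add_comm]
    congr 2 <;> split_ifs <;> simp_all
  have htr : ∀ x, star (tomographyDual d x).trace = (tomographyDual d x).trace := by
    intro x
    rw [← Matrix.trace_conjTranspose, (hH x).eq]
  refine ⟨{
    effect := tomographyEffect d
    posSemidef := fun x => (Matrix.posSemidef_vecMulVec_self_star _).smul
      (Complex.zero_le_real.mpr (by positivity))
    sum_effect := sum_tomographyEffect hd
    estimate := fun x => tomographyDual d x + ((1 - (tomographyDual d x).trace) / d) • 1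
    isHermitian := fun x => ?_
    trace_estimate := fun x => ?_
    unbiased := fun p q r s => ?_ }⟩
  · refine (hH x).add ?_
    unfold Matrix.IsHermitian
    rw [Matrix.conjTranspose_smul, Matrix.conjTranspose_one, star_div₀, star_sub, htr]
    simp
  · rw [Matrix.trace_add, Matrix.trace_smul, Matrix.trace_one, Fintype.card_fin, smul_eq_mul,
      div_mul_cancel₀ _ hd0]
    ring
  -- The trace correction does not affect unbiasedness: both `∑ₓ effectₓ` and `∑ₓ tr (dualₓ) •
  -- effectₓ` are the identity.
  · have h1 : ∑ x, (1 - (tomographyDual d x).trace) * tomographyEffect d x r s = 0 := by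
      simp only [sub_mul, one_mul, Finset.sum_sub_distrib, Matrix.trace, Matrix.diag_apply,
        Finset.sum_mul]
      rw [Finset.sum_comm, ← Matrix.sum_apply, sum_tomographyEffect hd]
      simp only [sum_tomographyDual_mul hd, Matrix.one_apply]
      by_cases h : r = s
      · subst h; simp
      · have h2 : ∀ c : Fin d, ¬(c = s ∧ c = r) := fun c hc => h (hc.2.symm.trans hc.1)
        simp [h2, h]
    have h2 : ∀ x, (tomographyDual d x +
        ((1 - (tomographyDual d x).trace) / d) • (1 : Matrix (Fin d) (Fin d) ℂ)) p q *
        tomographyEffect d x r s = tomographyDual d x p q * tomographyEffect d x r s +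
        ((1 : Matrix (Fin d) (Fin d) ℂ) p q / d) *
        ((1 - (tomographyDual d x).trace) * tomographyEffect d x r s) := by
      intro x
      simp only [Matrix.add_apply, Matrix.smul_apply, smul_eq_mul]
      ring
    simp_rw [h2]
    rw [Finset.sum_add_distrib, ← Finset.mul_sum, h1, mul_zero, add_zero,
      sum_tomographyDual_mul hd]

lemma ofReal_fidelity {d : ℕ} {A : Matrix (Fin d) (Fin d) ℂ} (hA : A.IsHermitian)
    (ψ : PureState d) :
    ((fidelity ψ A : ℝ) : ℂ) = ∑ a, ∑ b, star (ψ.1 a) * A a b * ψ.1 b := by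
  unfold fidelity
  have h : ∑ a, ∑ b, star (ψ.1 a) * A a b * ψ.1 b = star ψ.1.ofLp ⬝ᵥ A.mulVec ψ.1.ofLp := by
    simp only [dotProduct, Matrix.mulVec, Finset.mul_sum, Pi.star_apply, mul_assoc]
  apply Complex.ext
  · simp
  · rw [Complex.ofReal_im, h]
    exact (hA.im_star_dotProduct_mulVec_self _).symm

lemma posSemidef_of_fidelity_nonneg {d : ℕ} (hd : 1 ≤ d) {A : Matrix (Fin d) (Fin d) ℂ}
    (hA : A.IsHermitian) (h : ∀ ψ : PureState d, 0 ≤ fidelity ψ A) : A.PosSemidef := by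
  refine Matrix.PosSemidef.of_dotProduct_mulVec_nonneg hA fun v => ?_
  obtain ⟨φ, hφ⟩ := exists_pureState_smul hd v
  set r : ℝ := Real.sqrt (∑ c, ‖v c‖ ^ 2)
  have h1 : star v ⬝ᵥ A.mulVec v = ((r ^ 2 * fidelity φ A : ℝ) : ℂ) := by
    rw [Complex.ofReal_mul, ofReal_fidelity hA]
    simp only [dotProduct, Matrix.mulVec, Finset.mul_sum, Pi.star_apply, hφ, star_mul']
    refine Finset.sum_congr rfl fun a _ => Finset.sum_congr rfl fun b _ => ?_
    rw [← starRingEnd_apply, Complex.conj_ofReal]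
    push_cast
    ring
  rw [h1]
  exact Complex.zero_le_real.mpr (mul_nonneg (sq_nonneg r) (h φ))

/-! ### Local measurements on many systems and their correction to density operators -/

namespace Tomography

variable {d : ℕ} {Ω : Type} [Fintype Ω] (T : Tomography d Ω)

lemma sum_fidelity_smul (ψ : PureState d) :
    ∑ x, ((fidelity ψ (T.estimate x) : ℝ) : ℂ) • T.effect x = proj ψ := by
  ext r s
  rw [Matrix.sum_apply]
  simp only [Matrix.smul_apply, smul_eq_mul, ofReal_fidelity (T.isHermitian _), Finset.sum_mul]
  rw [Finset.sum_comm]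
  have h : ∀ p, ∑ x, ∑ q, star (ψ.1 p) * T.estimate x p q * ψ.1 q * T.effect x r s =
      ∑ q, star (ψ.1 p) * ψ.1 q * (if p = s ∧ q = r then 1 else 0) := by
    intro p
    rw [Finset.sum_comm]
    refine Finset.sum_congr rfl fun q _ => ?_
    rw [← T.unbiased, Finset.mul_sum]
    exact Finset.sum_congr rfl fun x _ => by ring
  simp_rw [h]
  simp [ite_and, proj, mul_comm]

/-- A bound for all estimated fidelities. -/
def bound : ℝ := ∑ x, ∑ p, ∑ q, ‖T.estimate x p q‖

lemma bound_nonneg : 0 ≤ T.bound := by unfold bound; positivity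

lemma abs_fidelity_le (x : Ω) (ψ : PureState d) : |fidelity ψ (T.estimate x)| ≤ T.bound := by
  have h1 : ∀ a, ‖ψ.1 a‖ ≤ 1 := fun a => (PiLp.norm_apply_le ψ.1 a).trans (by simp)
  have h2 : |fidelity ψ (T.estimate x)| ≤ ∑ p, ∑ q, ‖T.estimate x p q‖ := by
    refine (Complex.abs_re_le_norm _).trans ?_
    refine (norm_sum_le _ _).trans (Finset.sum_le_sum fun p _ => ?_)
    refine (norm_sum_le _ _).trans (Finset.sum_le_sum fun q _ => ?_)
    rw [norm_mul, norm_mul, norm_star]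
    calc ‖ψ.1 p‖ * ‖T.estimate x p q‖ * ‖ψ.1 q‖ ≤ 1 * ‖T.estimate x p q‖ * 1 := by
          gcongr
          · exact h1 p
          · exact h1 q
      _ = _ := by ring
  refine h2.trans ?_
  exact Finset.single_le_sum (f := fun x => ∑ p, ∑ q, ‖T.estimate x p q‖)
    (fun x _ => by positivity) (Finset.mem_univ x)

variable {M : ℕ}

/-- The joint effect for the word `w` of local outcomes. -/
def jointEffect (w : Fin M → Ω) : Op d M := tensor fun k => T.effect (w k)

lemma posSemidef_jointEffect (w : Fin M → Ω) : (T.jointEffect w).PosSemidef :=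
  posSemidef_tensor fun k => T.posSemidef (w k)

lemma sum_jointEffect : ∑ w : Fin M → Ω, T.jointEffect w = 1 := by
  unfold jointEffect
  rw [← tensor_sum (fun _ x => T.effect x)]
  simp only [T.sum_effect, tensor_one]

lemma sum_prod_smul_jointEffect (c : Fin M → Ω → ℂ) :
    ∑ w : Fin M → Ω, (∏ k, c k (w k)) • T.jointEffect w =
      tensor fun k => ∑ x, c k x • T.effect x := by
  rw [tensor_sum (fun k x => c k x • T.effect x)]
  exact Finset.sum_congr rfl fun w _ => (tensor_smul _ _).symm

lemma sum_fidelity_smul_jointEffect (k : Fin M) (ψ : PureState d) :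
    ∑ w : Fin M → Ω, ((fidelity ψ (T.estimate (w k)) : ℝ) : ℂ) • T.jointEffect w =
      site k (proj ψ) := by
  have h := T.sum_prod_smul_jointEffect
    (fun j x => if j = k then ((fidelity ψ (T.estimate x) : ℝ) : ℂ) else 1)
  simp only [Finset.prod_ite_eq', Finset.mem_univ, if_true] at h
  rw [h, ← tensor_site]
  congr 1
  ext1 j
  split_ifs
  · exact T.sum_fidelity_smul ψ
  · simp [T.sum_effect]

/-- Probability of the word `w` of local outcomes. -/
def prob (ρ : Op d M) (w : Fin M → Ω) : ℝ := (T.jointEffect w * ρ).trace.re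

lemma prob_nonneg {ρ : Op d M} (hρ : ρ.PosSemidef) (w : Fin M → Ω) : 0 ≤ T.prob ρ w :=
  re_trace_mul_nonneg (T.posSemidef_jointEffect w) hρ

lemma sum_prob {ρ : Op d M} (hρ1 : ρ.trace = 1) : ∑ w, T.prob ρ w = 1 := by
  unfold prob
  rw [← Complex.re_sum, ← Matrix.trace_sum, ← Finset.sum_mul, T.sum_jointEffect, one_mul, hρ1,
    Complex.one_re]

/-- Unbiasedness at site `k`, with the effects at all other sites summing to the identity. Nothing
is assumed about correlations in `ρ`. -/
lemma sum_prob_mul_fidelity (ρ : Op d M) (k : Fin M) (ψ : PureState d) :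
    ∑ w, T.prob ρ w * fidelity ψ (T.estimate (w k)) = fidelity ψ (reduced k ρ) := by
  rw [fidelity_reduced, Matrix.trace_mul_comm, ← T.sum_fidelity_smul_jointEffect, Finset.sum_mul,
    Matrix.trace_sum, Complex.re_sum]
  refine Finset.sum_congr rfl fun w _ => ?_
  rw [Matrix.smul_mul, Matrix.trace_smul, smul_eq_mul, Complex.re_ofReal_mul, mul_comm]
  rfl

/-- Exponential moments of the estimated fidelity are small, whatever the state. -/
lemma sum_prob_mul_exp_le {ρ : Op d M} (hρ : ρ.PosSemidef) (hρ1 : ρ.trace = 1) (φ : PureState d)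
    {t : ℝ} (ht : 0 ≤ t) (htC : t * T.bound ≤ 1) :
    ∑ w, T.prob ρ w * Real.exp (-t * ∑ k, fidelity φ (T.estimate (w k))) ≤
      (1 + (t * T.bound) ^ 2) ^ M := by
  set g : ℝ := 1 + (t * T.bound) ^ 2 with hg
  set h : Ω → ℝ := fun x => fidelity φ (T.estimate x) with hh
  set G : Matrix (Fin d) (Fin d) ℂ := ∑ x, ((Real.exp (-t * h x) : ℝ) : ℂ) • T.effect x with hG
  have hGpos : G.PosSemidef := Matrix.posSemidef_sum _ fun x _ =>
    (T.posSemidef x).smul (Complex.zero_le_real.mpr (Real.exp_nonneg _))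
  -- This is `exp y ≤ 1 + y + y²` for `|y| ≤ 1`, with `y = -t h x`.
  have hexp : ∀ x, 0 ≤ g - t * h x - Real.exp (-t * h x) := by
    intro x
    have h1 : |(-t * h x)| ≤ t * T.bound := by
      rw [abs_mul, abs_neg, abs_of_nonneg ht]
      exact mul_le_mul_of_nonneg_left (T.abs_fidelity_le x φ) ht
    have h2 := Real.abs_exp_sub_one_sub_id_le (h1.trans htC)
    have h3 : (-t * h x) ^ 2 ≤ (t * T.bound) ^ 2 := by
      rw [← sq_abs]; gcongr
    have h4 := (abs_le.mp h2).2
    rw [hg]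
    linarith
  -- The linear terms `t h x` reassemble to `t • proj φ` by the frame identity. It is positive, so
  -- no first-order term is left in the bound on `G`.
  have hGle : ((g : ℂ) • 1 - G).PosSemidef := by
    have h1 : (g : ℂ) • 1 - G = ∑ x, ((g - t * h x - Real.exp (-t * h x) : ℝ) : ℂ) • T.effect x +
        (t : ℂ) • proj φ := by
      rw [← T.sum_fidelity_smul φ, ← T.sum_effect, hG]
      simp only [Finset.smul_sum, ← Finset.sum_sub_distrib, ← Finset.sum_add_distrib, smul_smul]
      refine Finset.sum_congr rfl fun x _ => ?_
      rw [← sub_smul, ← add_smul]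
      congr 1
      push_cast
      simp only [hh]
      ring
    rw [h1]
    refine (Matrix.posSemidef_sum _ fun x _ =>
      (T.posSemidef x).smul (Complex.zero_le_real.mpr (hexp x))).add ?_
    have h2 : proj φ = Matrix.vecMulVec φ.1.ofLp (star φ.1.ofLp) := rfl
    rw [h2]
    exact (Matrix.posSemidef_vecMulVec_self_star _).smul (Complex.zero_le_real.mpr ht)
  have h1 := re_trace_mul_nonneg (posSemidef_pow_sub_tensor (M := M) hGpos hGle) hρ
  have h2 := T.sum_prod_smul_jointEffect (M := M)
    (fun _ x => ((Real.exp (-t * h x) : ℝ) : ℂ))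
  rw [← hG] at h2
  have h3 : ∑ w, T.prob ρ w * Real.exp (-t * ∑ k, h (w k)) =
      ((tensor fun _ : Fin M => G) * ρ).trace.re := by
    rw [← h2, Finset.sum_mul, Matrix.trace_sum, Complex.re_sum]
    refine Finset.sum_congr rfl fun w _ => ?_
    rw [← Complex.ofReal_prod, ← Real.exp_sum, ← Finset.mul_sum, Matrix.smul_mul,
      Matrix.trace_smul, smul_eq_mul, Complex.re_ofReal_mul, mul_comm]
    rfl
  rw [h3]
  rw [Matrix.sub_mul, Matrix.trace_sub, Complex.sub_re, Matrix.smul_mul, one_mul,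
    Matrix.trace_smul, hρ1, smul_eq_mul, mul_one, Complex.ofReal_re] at h1
  linarith

/-- The average of the local estimates. -/
def mean (w : Fin M → Ω) : Matrix (Fin d) (Fin d) ℂ :=
  ((1 / M : ℝ) : ℂ) • ∑ k, T.estimate (w k)

lemma fidelity_mean (w : Fin M → Ω) (ψ : PureState d) :
    fidelity ψ (T.mean w) = 1 / M * ∑ k, fidelity ψ (T.estimate (w k)) := by
  rw [mean, fidelity_smul, fidelity_sum]

lemma isHermitian_mean (w : Fin M → Ω) : (T.mean w).IsHermitian := by
  unfold Matrix.IsHermitian mean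
  rw [Matrix.conjTranspose_smul, Matrix.conjTranspose_sum, ← starRingEnd_apply,
    Complex.conj_ofReal]
  congr 1
  exact Finset.sum_congr rfl fun k _ => T.isHermitian _

lemma trace_mean (hM : 1 ≤ M) (w : Fin M → Ω) : (T.mean w).trace = 1 := by
  have hM0 : (M : ℂ) ≠ 0 := by exact_mod_cast (by omega : M ≠ 0)
  rw [mean, Matrix.trace_smul, Matrix.trace_sum]
  simp [T.trace_estimate, hM0]

lemma fidelity_mean_le (hM : 1 ≤ M) (w : Fin M → Ω) (ψ : PureState d) :
    fidelity ψ (T.mean w) ≤ T.bound := by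
  have hM0 : (M : ℝ) ≠ 0 := by exact_mod_cast (by omega : M ≠ 0)
  rw [fidelity_mean]
  calc 1 / (M : ℝ) * ∑ k, fidelity ψ (T.estimate (w k)) ≤ 1 / (M : ℝ) * ∑ _k : Fin M, T.bound := by
        gcongr with k
        exact (abs_le.mp (T.abs_fidelity_le _ ψ)).2
    _ = _ := by simp [hM0]

lemma sum_prob_mul_fidelity_mean (ρ : Op d M) (ψ : PureState d) :
    ∑ w, T.prob ρ w * fidelity ψ (T.mean w) = 1 / M * ∑ k, fidelity ψ (reduced k ρ) := by
  simp only [fidelity_mean, ← T.sum_prob_mul_fidelity ρ, Finset.mul_sum]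
  rw [Finset.sum_comm]
  exact Finset.sum_congr rfl fun k _ => Finset.sum_congr rfl fun w _ => by ring

/-- The estimated fidelity with a fixed state is rarely negative. -/
lemma sum_prob_mul_neg_le {ρ : Op d M} (hρ : ρ.PosSemidef) (hρ1 : ρ.trace = 1) (hM : 1 ≤ M)
    (hC : T.bound ^ 2 ≤ M) (φ : PureState d) :
    ∑ w, T.prob ρ w * max (-fidelity φ (T.mean w)) 0 ≤
      Real.exp (T.bound ^ 2) / Real.sqrt M := by
  have hM0 : (0 : ℝ) < M := by exact_mod_cast hM
  have hs : 0 < Real.sqrt M := Real.sqrt_pos.mpr hM0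
  -- With this `t` the bound `(1 + t² C²) ^ M` stays below `exp (C²)`, where `C = T.bound`, while
  -- the exponent is `√M` times the negated mean fidelity.
  set t : ℝ := 1 / Real.sqrt M with ht
  have ht0 : 0 ≤ t := by positivity
  have htC2 : (t * T.bound) ^ 2 = T.bound ^ 2 / M := by
    rw [ht, mul_pow, div_pow, one_pow, Real.sq_sqrt hM0.le]; ring
  have htC : t * T.bound ≤ 1 := by
    have : (t * T.bound) ^ 2 ≤ 1 := by
      rw [htC2]; exact (div_le_one hM0).mpr hC
    exact (abs_le_one_iff_mul_self_le_one.mpr (by rwa [← sq])) |> fun h => (abs_le.mp h).2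
  have h1 := T.sum_prob_mul_exp_le hρ hρ1 φ ht0 htC
  have h2 : (1 + (t * T.bound) ^ 2) ^ M ≤ Real.exp (T.bound ^ 2) := by
    calc (1 + (t * T.bound) ^ 2) ^ M ≤ (Real.exp (T.bound ^ 2 / M)) ^ M := by
          gcongr
          rw [htC2, add_comm]
          exact Real.add_one_le_exp _
      _ = _ := by
          rw [← Real.exp_nat_mul]
          congr 1
          field_simp
  have h3 : ∀ w : Fin M → Ω, Real.sqrt M * max (-fidelity φ (T.mean w)) 0 ≤
      Real.exp (-t * ∑ k, fidelity φ (T.estimate (w k))) := by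
    intro w
    have h4 : -t * ∑ k, fidelity φ (T.estimate (w k)) =
        Real.sqrt M * -fidelity φ (T.mean w) := by
      rw [fidelity_mean, ht]
      field_simp
      rw [Real.sq_sqrt hM0.le]
      ring
    rw [h4, mul_max_of_nonneg _ _ hs.le, mul_zero]
    refine max_le ?_ (Real.exp_nonneg _)
    have := Real.add_one_le_exp (Real.sqrt M * -fidelity φ (T.mean w))
    linarith
  rw [le_div_iff₀ hs, mul_comm, Finset.mul_sum]
  refine le_trans ?_ (h1.trans h2)
  refine Finset.sum_le_sum fun w _ => ?_
  calc _ = T.prob ρ w * (Real.sqrt M * max (-fidelity φ (T.mean w)) 0) := by ring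
    _ ≤ _ := mul_le_mul_of_nonneg_left (h3 w) (T.prob_nonneg hρ w)

/-- Finitely many states approximate the estimated fidelities with all states. -/
lemma exists_net {δ : ℝ} (hδ : 0 < δ) : ∃ S : Finset (PureState d),
    ∀ ψ : PureState d, ∃ φ ∈ S, ∀ x,
      |fidelity ψ (T.estimate x) - fidelity φ (T.estimate x)| ≤ δ := by
  let H : PureState d → Ω → ℝ := fun ψ x => fidelity ψ (T.estimate x)
  have hH : Continuous H := continuous_pi fun x => continuous_fidelity _
  obtain ⟨S, -, hS⟩ := (isCompact_univ (X := PureState d)).elim_nhds_subcover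
    (fun φ => H ⁻¹' Metric.ball (H φ) δ)
    (fun φ _ => hH.continuousAt.preimage_mem_nhds (Metric.ball_mem_nhds _ hδ))
  refine ⟨S, fun ψ => ?_⟩
  have h := hS (Set.mem_univ ψ)
  simp only [Set.mem_iUnion] at h
  obtain ⟨φ, hφ, h1⟩ := h
  refine ⟨φ, hφ, fun x => ?_⟩
  exact ((dist_le_pi_dist (H ψ) (H φ) x).trans_lt h1).le

/-- A nonnegative correction that makes the mean estimate positive. -/
def correction (S : Finset (PureState d)) (δ : ℝ) (w : Fin M → Ω) : ℝ :=
  δ + ∑ φ ∈ S, max (-fidelity φ (T.mean w)) 0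

lemma correction_nonneg (S : Finset (PureState d)) {δ : ℝ} (hδ : 0 < δ) (w : Fin M → Ω) :
    0 ≤ T.correction S δ w :=
  add_nonneg hδ.le (Finset.sum_nonneg fun _ _ => le_max_right _ _)

lemma fidelity_mean_add_correction_nonneg (hM : 1 ≤ M) {S : Finset (PureState d)} {δ : ℝ}
    (hS : ∀ ψ : PureState d, ∃ φ ∈ S, ∀ x,
      |fidelity ψ (T.estimate x) - fidelity φ (T.estimate x)| ≤ δ)
    (w : Fin M → Ω) (ψ : PureState d) :
    0 ≤ fidelity ψ (T.mean w) + T.correction S δ w := by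
  have hM0 : (M : ℝ) ≠ 0 := by exact_mod_cast (by omega : M ≠ 0)
  obtain ⟨φ, hφ, h⟩ := hS ψ
  have h1 : fidelity φ (T.mean w) - δ ≤ fidelity ψ (T.mean w) := by
    have h2 : δ = 1 / (M : ℝ) * ∑ _k : Fin M, δ := by simp [hM0]
    rw [fidelity_mean, fidelity_mean, h2, ← mul_sub, ← Finset.sum_sub_distrib]
    gcongr with k
    have := (abs_le.mp (h (w k))).1
    linarith
  have h3 : max (-fidelity φ (T.mean w)) 0 ≤ ∑ φ ∈ S, max (-fidelity φ (T.mean w)) 0 :=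
    Finset.single_le_sum (f := fun φ => max (-fidelity φ (T.mean w)) 0)
      (fun _ _ => le_max_right _ _) hφ
  have h4 := le_max_left (-fidelity φ (T.mean w)) 0
  unfold correction
  linarith

/-- The corrected and normalised mean estimate, which is a density operator. -/
def guess (S : Finset (PureState d)) (δ : ℝ) (w : Fin M → Ω) : Matrix (Fin d) (Fin d) ℂ :=
  (((1 + d * T.correction S δ w)⁻¹ : ℝ) : ℂ) • (T.mean w + (T.correction S δ w : ℂ) • 1)

lemma posSemidef_guess (hd : 1 ≤ d) (hM : 1 ≤ M) {S : Finset (PureState d)} {δ : ℝ} (hδ : 0 < δ)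
    (hS : ∀ ψ : PureState d, ∃ φ ∈ S, ∀ x,
      |fidelity ψ (T.estimate x) - fidelity φ (T.estimate x)| ≤ δ)
    (w : Fin M → Ω) : (T.guess S δ w).PosSemidef := by
  have hη := T.correction_nonneg S hδ w
  refine Matrix.PosSemidef.smul ?_ (Complex.zero_le_real.mpr (by positivity))
  refine posSemidef_of_fidelity_nonneg hd ?_ fun ψ => ?_
  · refine (T.isHermitian_mean w).add ?_
    unfold Matrix.IsHermitian
    rw [Matrix.conjTranspose_smul, Matrix.conjTranspose_one, ← starRingEnd_apply,
      Complex.conj_ofReal]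
  · rw [fidelity_add, fidelity_smul, fidelity_one, mul_one]
    exact T.fidelity_mean_add_correction_nonneg hM hS w ψ

lemma trace_guess (hM : 1 ≤ M) (S : Finset (PureState d)) {δ : ℝ} (hδ : 0 < δ)
    (w : Fin M → Ω) : (T.guess S δ w).trace = 1 := by
  have hη := T.correction_nonneg S hδ w
  have h : (1 + d * T.correction S δ w : ℂ) ≠ 0 := by
    exact_mod_cast (by positivity : 1 + d * T.correction S δ w ≠ 0)
  rw [guess, Matrix.trace_smul, Matrix.trace_add, Matrix.trace_smul, T.trace_mean hM,
    Matrix.trace_one, Fintype.card_fin]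
  push_cast
  rw [smul_eq_mul, smul_eq_mul, mul_comm (T.correction S δ w : ℂ), inv_mul_cancel₀ h]

/-- The guess has fidelity `(s + η)/(1 + dη)` where the mean has `s`. Since `s` is at most
`T.bound`, the normalisation costs at most `d * T.bound * η`. -/
lemma le_fidelity_guess (hM : 1 ≤ M) (S : Finset (PureState d)) {δ : ℝ} (hδ : 0 < δ)
    (w : Fin M → Ω) (ψ : PureState d) :
    fidelity ψ (T.mean w) - d * T.bound * T.correction S δ w ≤ fidelity ψ (T.guess S δ w) := by
  have hη := T.correction_nonneg S hδ w
  have hC := T.bound_nonneg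
  have hle := T.fidelity_mean_le hM w ψ
  set η := T.correction S δ w
  set s := fidelity ψ (T.mean w)
  have h : fidelity ψ (T.guess S δ w) = (s + η) / (1 + d * η) := by
    rw [guess, fidelity_smul, fidelity_add, fidelity_smul, fidelity_one, mul_one]
    ring
  rw [h, le_div_iff₀ (by positivity)]
  have h1 : (d * η) * s ≤ d * η * T.bound := by gcongr
  have h2 : 0 ≤ (d * T.bound * η) * (d * η) := by positivity
  nlinarith

/-- Measuring `M` systems locally, one can guess a state whose average fidelity with any pure state
is almost that of the reduced states. -/
lemma le_sum_prob_mul_fidelity_guess {ρ : Op d M} (hρ : ρ.PosSemidef) (hρ1 : ρ.trace = 1)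
    (hM : 1 ≤ M) (hC : T.bound ^ 2 ≤ M) (S : Finset (PureState d)) {δ : ℝ} (hδ : 0 < δ)
    (ψ : PureState d) :
    1 / M * ∑ k, fidelity ψ (reduced k ρ) -
      d * T.bound * (δ + S.card * (Real.exp (T.bound ^ 2) / Real.sqrt M)) ≤
      ∑ w, T.prob ρ w * fidelity ψ (T.guess S δ w) := by
  have h1 : ∑ w, T.prob ρ w * T.correction S δ w ≤
      δ + S.card * (Real.exp (T.bound ^ 2) / Real.sqrt M) := by
    simp only [correction, mul_add, Finset.sum_add_distrib, ← Finset.sum_mul, T.sum_prob hρ1,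
      one_mul, Finset.mul_sum]
    gcongr
    rw [Finset.sum_comm, ← nsmul_eq_mul]
    exact Finset.sum_le_card_nsmul _ _ _ fun φ _ => T.sum_prob_mul_neg_le hρ hρ1 hM hC φ
  have hC := T.bound_nonneg
  calc _ ≤ ∑ w, T.prob ρ w * fidelity ψ (T.mean w) -
        d * T.bound * ∑ w, T.prob ρ w * T.correction S δ w := by
        rw [T.sum_prob_mul_fidelity_mean]
        gcongr
    _ = ∑ w, T.prob ρ w * (fidelity ψ (T.mean w) - d * T.bound * T.correction S δ w) := by
        rw [Finset.mul_sum, ← Finset.sum_sub_distrib]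
        exact Finset.sum_congr rfl fun w _ => by ring
    _ ≤ _ := Finset.sum_le_sum fun w _ =>
        mul_le_mul_of_nonneg_left (T.le_fidelity_guess hM S hδ w ψ) (T.prob_nonneg hρ w)

end Tomography

/-! ### Asymptotic cloning is estimation -/

/-- A measurement of the output of a cloner is a measurement of its input. -/
lemma Cloner.exists_pullback {d N M : ℕ} (L : Cloner d N M) {ι : Type*} [Fintype ι]
    (E : ι → Op d M) (hE : ∀ i, (E i).PosSemidef) (hE1 : ∑ i, E i = 1) :
    ∃ F : ι → Op d N, (∀ i, (F i).PosSemidef) ∧ ∑ i, F i = 1 ∧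
      ∀ i X, (F i * X).trace = (E i * L.toMap X).trace := by
  obtain ⟨s, A, hA⟩ := L.completelyPositive.exists_kraus
  have h1 : ∀ B X, ((∑ j, (A j).conjTranspose * B * A j) * X).trace = (B * L.toMap X).trace := by
    intro B X
    rw [hA, LinearMap.sum_apply, Finset.sum_mul, Finset.mul_sum, Matrix.trace_sum,
      Matrix.trace_sum]
    refine Finset.sum_congr rfl fun j _ => ?_
    rw [conjMap_apply, Matrix.mul_assoc, Matrix.mul_assoc, Matrix.trace_mul_comm]
    simp only [Matrix.mul_assoc]
  refine ⟨fun i => ∑ j, (A j).conjTranspose * E i * A j, fun i => ?_, ?_, fun i X => h1 _ X⟩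
  · exact Matrix.posSemidef_sum _ fun j _ => (hE i).conjTranspose_mul_mul_same _
  · have h2 : ∑ i, ∑ j, (A j).conjTranspose * E i * A j =
        ∑ j, (A j).conjTranspose * (1 : Op d M) * A j := by
      rw [Finset.sum_comm]
      refine Finset.sum_congr rfl fun j _ => ?_
      rw [← Matrix.sum_mul, ← Matrix.mul_sum, hE1]
    rw [h2]
    -- The adjoint of a trace-preserving map is unital, as seen by testing against every `X`.
    refine Matrix.ext_iff_trace_mul_right.mpr fun X => ?_
    rw [h1, one_mul, one_mul, L.trace_map]

lemma Cloner.posSemidef_toMap {d N M : ℕ} (L : Cloner d N M) {X : Op d N} (hX : X.PosSemidef) :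
    (L.toMap X).PosSemidef := by
  obtain ⟨s, A, hA⟩ := L.completelyPositive.exists_kraus
  rw [hA, LinearMap.sum_apply]
  exact Matrix.posSemidef_sum _ fun j _ => hX.mul_mul_conjTranspose_same _

lemma Cloner.continuous_cloneFidelity {d N M : ℕ} (L : Cloner d N M) (k : Fin M) :
    Continuous (L.cloneFidelity k) := by
  have h1 : Continuous L.toMap := L.toMap.continuous_of_finiteDimensional
  have h2 : Continuous fun ψ : PureState d => (site k (proj ψ) : Op d M) := by
    refine continuous_pi fun x => continuous_pi fun y => ?_
    unfold site proj
    split_ifs <;> fun_prop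
  unfold Cloner.cloneFidelity
  simp_rw [fidelity_reduced]
  exact Complex.continuous_re.comp
    ((h1.comp (continuous_copies N)).matrix_mul h2).matrix_trace

/-- Asymptotically, no cloner beats the optimal estimation of the input. -/
lemma eventually_avgFidelity_le {d : ℕ} (hd : 1 ≤ d) (N : ℕ) (ν : Measure (PureState d))
    [IsProbabilityMeasure ν] {ε : ℝ} (hε : 0 < ε) :
    ∀ᶠ M in atTop, ∀ L : Cloner d N M, L.avgFidelity ν ≤ optEstimation ν N + ε := by
  obtain ⟨T⟩ := exists_tomography hd
  have hC := T.bound_nonneg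
  set B : ℝ := d * T.bound with hB
  have hB0 : 0 ≤ B := by positivity
  -- This makes `B * δ` smaller than `ε`, and the `+ 1` covers `B = 0`. The other error term
  -- vanishes as `M → ∞`, and no threshold on `M` involves the cloner.
  set δ : ℝ := ε / (2 * (B + 1)) with hδ
  have hδ0 : 0 < δ := by positivity
  obtain ⟨S, hS⟩ := T.exists_net hδ0
  have hlim : Tendsto (fun M : ℕ => B * (δ + S.card * (Real.exp (T.bound ^ 2) / Real.sqrt M)))
      atTop (𝓝 (B * (δ + S.card * 0))) := by
    refine (((tendsto_const_nhds.div_atTop ?_).const_mul _).const_add _).const_mul _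
    exact Real.tendsto_sqrt_atTop.comp tendsto_natCast_atTop_atTop
  have hlt : B * (δ + S.card * 0) < ε := by
    rw [mul_zero, add_zero, hδ, mul_div_assoc', div_lt_iff₀ (by positivity)]
    nlinarith
  filter_upwards [hlim.eventually_lt_const hlt, eventually_ge_atTop 1,
    tendsto_natCast_atTop_atTop.eventually_ge_atTop (T.bound ^ 2)] with M hM1 hM hM2 L
  obtain ⟨F, hF, hF1, hFL⟩ := L.exists_pullback T.jointEffect T.posSemidef_jointEffect
    T.sum_jointEffect
  have h1 := le_optEstimation_of_mixed hd ν F hF hF1 (T.guess S δ)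
    (T.posSemidef_guess hd hM hδ0 hS) (T.trace_guess hM S hδ0)
  have hint : Integrable (fun ψ => 1 / (M : ℝ) * ∑ k, L.cloneFidelity k ψ) ν :=
    integrable_of_continuous
      (continuous_const.mul (continuous_finsetSum _ fun k _ => L.continuous_cloneFidelity k))
  have h2 : L.avgFidelity ν = ∫ ψ, 1 / (M : ℝ) * ∑ k, L.cloneFidelity k ψ ∂ν := by
    unfold Cloner.avgFidelity
    simp_rw [Finset.mul_sum]
    rw [integral_finsetSum]
    exact fun k _ => integrable_of_continuous
      (continuous_const.mul (L.continuous_cloneFidelity k))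
  have h3 : L.avgFidelity ν - ε ≤
      ∫ ψ, ∑ w, ((F w * copies N ψ).trace).re * fidelity ψ (T.guess S δ w) ∂ν := by
    have h4 : ∫ ψ, (1 / (M : ℝ) * ∑ k, L.cloneFidelity k ψ - ε) ∂ν = L.avgFidelity ν - ε := by
      rw [integral_sub hint (integrable_const _), ← h2]
      simp
    rw [← h4]
    refine integral_mono (hint.sub (integrable_const _)) (integrable_of_continuous
      (continuous_finsetSum _ fun w _ => (continuous_outcome _).mul (continuous_fidelity _)))
      fun ψ => ?_
    have h5 := T.le_sum_prob_mul_fidelity_guess (L.posSemidef_toMap (posSemidef_copies N ψ))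
      ((L.trace_map _).trans (trace_copies N ψ)) hM hM2 S hδ0 ψ
    have h6 : ∀ w, ((F w * copies N ψ).trace).re = T.prob (L.toMap (copies N ψ)) w := fun w => by
      rw [hFL]; rfl
    simp only [h6]
    refine le_trans ?_ h5
    have h7 : ∑ k, L.cloneFidelity k ψ = ∑ k, fidelity ψ (reduced k (L.toMap (copies N ψ))) := rfl
    rw [h7]
    linarith
  linarith

/-- The asymptotic cloning attack is equivalent to the estimation attack. -/
lemma tendsto_optCloning {d : ℕ} (hd : 1 ≤ d) (N : ℕ) (ν : Measure (PureState d))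
    [IsProbabilityMeasure ν] :
    Tendsto (fun M : ℕ => optCloning ν N M) atTop (𝓝 (optEstimation ν N)) := by
  have := nonempty_estimator hd N
  have hE : (Set.range fun E : Estimator d N => E.avgFidelity ν).Nonempty :=
    Set.range_nonempty _
  rw [Metric.tendsto_nhds]
  intro ε hε
  filter_upwards [eventually_avgFidelity_le hd N ν (half_pos hε), eventually_ge_atTop 1]
    with M hM hM1
  have : Nonempty (Cloner d N M) := ⟨(nonempty_estimator hd N).some.toCloner M⟩
  have h1 : optCloning ν N M ≤ optEstimation ν N + ε / 2 :=
    csSup_le (Set.range_nonempty _) (by rintro _ ⟨L, rfl⟩; exact hM L)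
  have h2 : optEstimation ν N ≤ optCloning ν N M := by
    refine csSup_le hE ?_
    rintro _ ⟨E, rfl⟩
    -- The uniform upper bound also supplies the boundedness without which the supremum would take a
    -- default value.
    refine le_csSup ⟨optEstimation ν N + ε / 2, by rintro _ ⟨L, rfl⟩; exact hM L⟩ ?_
    exact ⟨E.toCloner M, E.avgFidelity_toCloner hM1 ν⟩
  rw [Real.dist_eq, abs_lt]
  constructor <;> linarith

/-! ### The optimal fidelities for uniformly distributed inputs -/

lemma universalCloner_avgFidelity {d N : ℕ} (hd : 1 ≤ d) (hN : 1 ≤ N) (m : ℕ)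
    (ν : Measure (PureState d)) [IsProbabilityMeasure ν] :
    (universalCloner hd N m).avgFidelity ν =
      (((N + m : ℕ) : ℝ) - N + N * ((N + m : ℕ) + d)) / ((N + m : ℕ) * (N + d)) := by
  have hNm : (N + m : ℝ) ≠ 0 := by exact_mod_cast (by omega : N + m ≠ 0)
  unfold Cloner.avgFidelity
  simp only [universalCloner_cloneFidelity hd hN, integral_const, probReal_univ, one_smul,
    Finset.sum_const, Finset.card_univ, Fintype.card_fin, nsmul_eq_mul]
  push_cast
  rw [← mul_assoc, mul_one_div_cancel hNm, one_mul]
  congr 1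
  ring

lemma Cloner.avgFidelity_uniform_le {d N M : ℕ} (hd : 1 ≤ d) (hM : 1 ≤ M) (L : Cloner d N M) :
    L.avgFidelity (uniform d) ≤ ((M : ℝ) - N + N * (M + d)) / (M * (N + d)) :=
  have := isProbabilityMeasure_uniform hd
  L.avgFidelity_le_of_moments hd hM (integral_copies_uniform hd)

lemma optUniversalCloning_eq {d N M : ℕ} (hd : 1 ≤ d) (hN : 1 ≤ N) (hNM : N ≤ M) :
    optUniversalCloning d N M = ((M : ℝ) - N + N * (M + d)) / (M * (N + d)) := by
  have := isProbabilityMeasure_uniform hd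
  obtain ⟨m, rfl⟩ := Nat.exists_eq_add_of_le hNM
  refine IsGreatest.csSup_eq ⟨⟨universalCloner hd N m, universalCloner_isUniversal hd hN m, ?_⟩, ?_⟩
  · rw [universalCloner_avgFidelity hd hN]
  · rintro _ ⟨L, -, rfl⟩
    exact L.avgFidelity_uniform_le hd (by omega)

/-- The upper bound never uses universality, so unrestricted cloning has the same optimum. This
links the formula to estimation, since the general limit concerns unrestricted cloners. -/
lemma optCloning_uniform_eq {d N M : ℕ} (hd : 1 ≤ d) (hN : 1 ≤ N) (hNM : N ≤ M) :
    optCloning (uniform d) N M = ((M : ℝ) - N + N * (M + d)) / (M * (N + d)) := by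
  have := isProbabilityMeasure_uniform hd
  obtain ⟨m, rfl⟩ := Nat.exists_eq_add_of_le hNM
  refine IsGreatest.csSup_eq ⟨⟨universalCloner hd N m, ?_⟩, ?_⟩
  · exact universalCloner_avgFidelity hd hN m _
  · rintro _ ⟨L, rfl⟩
    exact L.avgFidelity_uniform_le hd (by omega)

lemma tendsto_cloning_formula {d N : ℕ} (hN : 1 ≤ N) :
    Tendsto (fun M : ℕ => ((M : ℝ) - N + N * (M + d)) / (M * (N + d))) atTop
      (𝓝 (((N : ℝ) + 1) / (N + d))) := by
  have hNd : (N + d : ℝ) ≠ 0 := by exact_mod_cast (by omega : N + d ≠ 0)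
  have h1 : Tendsto (fun M : ℕ => ((N : ℝ) + 1) / (N + d) + (N * (d - 1) / (N + d)) / M) atTop
      (𝓝 (((N : ℝ) + 1) / (N + d) + 0)) :=
    (tendsto_const_nhds.div_atTop tendsto_natCast_atTop_atTop).const_add _
  rw [add_zero] at h1
  refine h1.congr' ?_
  filter_upwards [eventually_ge_atTop 1] with M hM
  have hM0 : (M : ℝ) ≠ 0 := by exact_mod_cast (by omega : M ≠ 0)
  field_simp
  ring

/-- By uniqueness of limits: optimal cloning tends both to optimal estimation and to the limit of
the explicit formula, so no optimal measurement has to be exhibited. -/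
lemma optEstimation_uniform {d N : ℕ} (hd : 1 ≤ d) (hN : 1 ≤ N) :
    optEstimation (uniform d) N = ((N : ℝ) + 1) / (N + d) := by
  have := isProbabilityMeasure_uniform hd
  refine tendsto_nhds_unique (tendsto_optCloning hd N (uniform d))
    ((tendsto_cloning_formula hN).congr' ?_)
  filter_upwards [eventually_ge_atTop N] with M hM
  exact (optCloning_uniform_eq hd hN hM).symm

end QuantumCloning

end

theorem theorem3 (d N : ℕ) (hd : 1 ≤ d) (hN : 1 ≤ N) :
    (∀ ν : Measure (QuantumCloning.PureState d), IsProbabilityMeasure ν →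
      Tendsto (fun M : ℕ => QuantumCloning.optCloning ν N M) atTop
        (𝓝 (QuantumCloning.optEstimation ν N))) ∧
    (∀ M : ℕ, N ≤ M →
      QuantumCloning.optUniversalCloning d N M =
        ((M : ℝ) - N + N * (M + d)) / (M * (N + d))) ∧
    QuantumCloning.optEstimation (QuantumCloning.uniform d) N = ((N : ℝ) + 1) / (N + d) ∧
    Tendsto (fun M : ℕ => QuantumCloning.optUniversalCloning d N M) atTop
      (𝓝 (QuantumCloning.optEstimation (QuantumCloning.uniform d) N)) := by
  refine ⟨fun ν _ => QuantumCloning.tendsto_optCloning hd N ν,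
    fun M hM => QuantumCloning.optUniversalCloning_eq hd hN hM,
    QuantumCloning.optEstimation_uniform hd hN, ?_⟩
  rw [QuantumCloning.optEstimation_uniform hd hN]
  refine (QuantumCloning.tendsto_cloning_formula hN).congr' ?_
  filter_upwards [eventually_ge_atTop N] with M hM
  exact (QuantumCloning.optUniversalCloning_eq hd hN hM).symm
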